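/- **Model.** Two terminals $T_1,T_2$ exchange data through a relay $R$. Node $N\in\{T_1,T_2,R\}$ has $L_N\ge 1$ co-channel interferers of power $P_{I,N}>0$; the terminals and the relay transmit with power $P>0$, and $\omega_1,\omega_2>0$, $\omega_1+\omega_2=1$. The channel coefficients $h_0$ ($T_1$–$T_2$), $h_i$ ($T_i$–$R$, $i=1,2$) and $c_{N,k}$ ($k=1,\dots,L_N$) are independent with laws $\mathcal{CN}(0,\Omega_0)$, $\mathcal{CN}(0,\Omega_i)$, $\mathcal{CN}(0,\Omega_{N,k})$ of positive variance. Put $\gamma_i=P|h_i|^2$, $\bar\gamma_i=P\Omega_i$ ($i=0,1,2$), $\Gamma_N=\sum_k P_{I,N}|c_{N,k}|^2$, $\xi_{N,k}=P_{I,N}\Omega_{N,k}$. For $\{i,j\}=\{1,2\}$ let $$\Upsilon_{T_i,D}=\frac{\gamma_0}{\Gamma_{T_i}+1},\quad \Upsilon_{T_i,1}=\frac{\gamma_i}{\Gamma_{T_i}+1},\quad \Upsilon_{T_i,2}=\frac{\omega_j\gamma_j}{\Gamma_R+\omega_i\Gamma_{T_i}+\omega_i+1},$$ $$\Upsilon_{T_i}=\Upsilon_{T_i,D}+\frac{\Upsilon_{T_i,1}\Upsilon_{T_i,2}}{\Upsilon_{T_i,1}+\Upsilon_{T_i,2}},\qquad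 \Upsilon^{UB}_{T_i}=\Upsilon_{T_i,D}+\min\{\Upsilon_{T_i,1},\Upsilon_{T_i,2}\}.$$ The protocol outage probability at the threshold $\gamma$ is $P_{pro}(\gamma)=p_1+p_2-p_1p_2$ with $p_i=\Pr(\Upsilon_{T_i}<\gamma)$; $P^{LB}_{pro}(\gamma)$ is the same expression with $p_i=\Pr(\Upsilon^{UB}_{T_i}<\gamma)$. **Closed forms.** For $m=1,2$ let $\Phi_m=\frac1{\bar\gamma_0}-\frac1{\bar\gamma_i}-\frac{\omega_i+m-1}{\omega_j\bar\gamma_j}$ and $\lambda_m=\frac1{\bar\gamma_i}+\frac{\omega_i+m-1}{\omega_j\bar\gamma_j}$ (they depend on the terminal $T_i$), and $\phi_{N,k}=\xi_{N,k}^{L_N-2}\prod_{l\ne k}\frac1{\xi_{N,k}-\xi_{N,l}}$. For an interferer $a$ of $T_i$ and an interferer $k$ of $R$ let $$\beta_{a,k}=\frac{\omega_j\bar\gamma_j\Phi_1}{\xi_{R,k}}+\frac1{\xi_{T_i,a}},\quad D_{a,k}=\frac{\gamma}{\bar\gamma_0}+\beta_{a,k},\quad \Lambda(\rho_1,\rho_2)=\frac{\bar\gamma_j}{D_{a,k}}\,\frac{e^{-\rho_2\gamma}}{\rho_1\gamma+1/\xi_{T_i,a}}.$$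 For a function $M(\rho_1,\dots,\rho_5)$, which may also depend on $i,a,k,\gamma$, put $$F_i[M](\gamma)=1-e^{-\gamma/\bar\gamma_0}\sum_a\phi_{T_i,a}\frac{\bar\gamma_0}{\gamma+\bar\gamma_0/\xi_{T_i,a}}-\frac{\omega_j}{\bar\gamma_0}\sum_{a,k}\phi_{T_i,a}\phi_{R,k}\Big(M\big(1,1,-\tfrac1{\bar\gamma_j},\tfrac1{\bar\gamma_j},\tfrac{\omega_j}{\xi_{R,k}}\big)+M\big(1,2,-\tfrac1{\bar\gamma_j},\tfrac1{\bar\gamma_j},\tfrac{\omega_j}{\xi_{R,k}}\big)$$ $$+M\big(\tfrac1{\omega_j},1,\Phi_1,\lambda_1,\tfrac1{\xi_{T_i,a}}\big)+M\big(\Phi_1\bar\gamma_j,2,\Phi_1,\lambda_1,\tfrac1{\xi_{T_i,a}}\big)+\Lambda(\lambda_1,\lambda_2)-\Lambda\big(\tfrac1{\bar\gamma_0},\tfrac1{\bar\gamma_0}\big)\Big).$$ With $\mathbb L(n,x)=\int_0^x t^{n-1}e^{-t}dt$ consider the integral $$M^{int}=\rho_1e^{-\lambda_2\gamma}D_{a,k}^{-\rho_2}\int_0^\gamma\frac{e^{-\Phi_2z}}{\rho_3z+\rho_4\gamma+\rho_5}dz,$$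 the series $$M=\frac{\rho_1e^{-\lambda_2\gamma}}{\rho_3}D_{a,k}^{-\rho_2}\sum_{l=0}^\infty(-1)^l\Big(\frac{\rho_3}{\rho_4\gamma+\rho_5}\Big)^{l+1}\Phi_2^{-l-1}\,\mathbb L(l+1,\Phi_2\gamma),$$ and the approximation $$\tilde M=\frac{\rho_1e^{-\lambda_2\gamma}}{\Phi_2}D_{a,k}^{-\rho_2}\,\frac{1-e^{-\Phi_2\gamma}}{(\rho_3+\rho_4)\gamma+\rho_5}.$$ Let $P^{App}_{pro}(\gamma)$ be $F_1+F_2-F_1F_2$ with $F_i=F_i[M^{fr}](\gamma)$, where $M^{fr}$ is $M^{int}$ with the variable $z$ in the denominator of the integrand replaced by $\gamma$. **Theorem.** Let $\gamma=\gamma_{th}>0$. Suppose that for each node $N$ the numbers $\xi_{N,k}$ are pairwise distinct and that, for both terminals and all $a,k$, $\Phi_2\ne0$ and $D_{a,k}\ne0$. Then: 1. $P^{LB}_{pro}(\gamma)\le P_{pro}(\gamma)$, $\Pr(\Upsilon^{UB}_{T_i}<\gamma)=F_i[M^{int}](\gamma)$ for $i=1,2$, and $P^{LB}_{pro}(\gamma)=F_1+F_2-F_1F_2$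 with $F_i=F_i[M^{int}](\gamma)$. 2. If moreover, for both terminals and all $a$, $\Phi_1\ne0$ and $|\Phi_1|\gamma\le\lambda_1\gamma+1/\xi_{T_i,a}$, then all the series $M$ that occur in $F_1[M](\gamma)$ and $F_2[M](\gamma)$ converge, $\Pr(\Upsilon^{UB}_{T_i}<\gamma)=F_i[M](\gamma)$ for $i=1,2$, and $P^{LB}_{pro}(\gamma)=F_1+F_2-F_1F_2$ with $F_i=F_i[M](\gamma)$. 3. $P^{App}_{pro}(\gamma)=F_1+F_2-F_1F_2$ with $F_i=F_i[\tilde M](\gamma)$. For both triples $(\rho_3,\rho_4,\rho_5)$ that occur in $F_i$, all real $\rho_1$ and all integers $\rho_2\ge0$, $|\tilde M-M^{int}|\le\frac{|\rho_3|\gamma}{(\rho_3+\rho_4)\gamma+\rho_5}\,|M^{int}|$. -/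

import Mathlib

open MeasureTheory ProbabilityTheory

noncomputable section

namespace TwoWayRelay

/-- The nodes of the network: the terminals `T 0`, `T 1` (written `T₁`, `T₂` in the literature)
and the relay `R`. -/
inductive Node where
  | T (i : Fin 2)
  | R

/-- The channels of the network, where node `N` suffers from `L N` interferers: the direct channel
between the terminals, the channel between terminal `i` and the relay, and the channel between
node `N` and its `k`-th interferer. -/
inductive Channel (L : Node → ℕ) where
  | direct
  | relay (i : Fin 2)
  | interf (N : Node) (k : Fin (L N))

/-- The other terminal. -/
def other (i : Fin 2) : Fin 2 := 1 - i

/-- The deterministic parameters of the three-phase two-way relaying network. -/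
structure Network where
  /-- numbers of interferers -/
  L : Node → ℕ
  L_pos : ∀ N, 0 < L N
  /-- common transmit power of the terminals and of the relay -/
  P : ℝ
  P_pos : 0 < P
  /-- transmit powers of the interferers of a node -/
  PI : Node → ℝ
  PI_pos : ∀ N, 0 < PI N
  /-- power allocation numbers at the relay -/
  ω : Fin 2 → ℝ
  ω_pos : ∀ i, 0 < ω i
  ω_sum : ω 0 + ω 1 = 1
  /-- variances of the channel coefficients -/
  variance : Channel L → ℝ
  variance_pos : ∀ c, 0 < variance c

/-- The circularly symmetric complex Gaussian law with mean zero and variance `v`: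
independent real and imaginary parts, each of variance `v / 2`. -/
def complexGaussian (v : ℝ) : Measure ℂ :=
  ((gaussianReal 0 (v / 2).toNNReal).prod (gaussianReal 0 (v / 2).toNNReal)).map
    (fun p : ℝ × ℝ => (⟨p.1, p.2⟩ : ℂ))

/-- `p + q - p q`. -/
def combine (p q : ℝ) : ℝ := p + q - p * q

/-- The lower incomplete gamma function of positive integer order `n`, at any real `x`. -/
def lowerGamma (n : ℕ) (x : ℝ) : ℝ := ∫ t in (0 : ℝ)..x, t ^ (n - 1) * Real.exp (-t)

/-- The outage probability `Pr (X < γ)`. -/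
def outage {S : Type*} [MeasurableSpace S] (μ : Measure S) (X : S → ℝ) (γ : ℝ) : ℝ := μ.real {s | X s < γ}

namespace Network

variable (net : Network) {S : Type*} [MeasurableSpace S]

/-- Independent Rayleigh fading: the channel coefficients are independent, centred, circularly
symmetric complex Gaussian variables with the prescribed variances. -/
structure IsFading (μ : Measure S) (h : Channel net.L → S → ℂ) : Prop where
  law : ∀ c, HasLaw (h c) (complexGaussian (net.variance c)) μ
  indep : iIndepFun h μ

/-! ### Random quantities -/

/-- Total instantaneous interference power at a node. -/
def Γ (h : Channel net.L → S → ℂ) (N : Node) (s : S) : ℝ :=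
  ∑ k, net.PI N * ‖h (.interf N k) s‖ ^ 2

/-- `γ₀`. -/
def gain₀ (h : Channel net.L → S → ℂ) (s : S) : ℝ := net.P * ‖h .direct s‖ ^ 2

/-- `γᵢ`, for the channel between terminal `i` and the relay. -/
def gain (h : Channel net.L → S → ℂ) (i : Fin 2) (s : S) : ℝ := net.P * ‖h (.relay i) s‖ ^ 2

/-- SINR of the direct channel at terminal `i`. -/
def sinrD (h : Channel net.L → S → ℂ) (i : Fin 2) (s : S) : ℝ :=
  net.gain₀ h s / (net.Γ h (.T i) s + 1)

def sinr₁ (h : Channel net.L → S → ℂ) (i : Fin 2) (s : S) : ℝ :=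
  net.gain h i s / (net.Γ h (.T i) s + 1)

def sinr₂ (h : Channel net.L → S → ℂ) (i : Fin 2) (s : S) : ℝ :=
  net.ω (other i) * net.gain h (other i) s /
    (net.Γ h .R s + net.ω i * net.Γ h (.T i) s + net.ω i + 1)

/-- The received SINR at terminal `i`. -/
def sinr (h : Channel net.L → S → ℂ) (i : Fin 2) (s : S) : ℝ :=
  net.sinrD h i s + net.sinr₁ h i s * net.sinr₂ h i s / (net.sinr₁ h i s + net.sinr₂ h i s)

/-- The harmonic-to-min upper bound of the received SINR at terminal `i`. -/
def sinrUB (h : Channel net.L → S → ℂ) (i : Fin 2) (s : S) : ℝ :=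
  net.sinrD h i s + min (net.sinr₁ h i s) (net.sinr₂ h i s)

/-- The protocol outage probability. -/
def protocolOutage (μ : Measure S) (h : Channel net.L → S → ℂ) (γ : ℝ) : ℝ :=
  combine (outage μ (net.sinr h 0) γ) (outage μ (net.sinr h 1) γ)

/-- The protocol outage probability evaluated with the SINR upper bounds. -/
def protocolOutageLB (μ : Measure S) (h : Channel net.L → S → ℂ) (γ : ℝ) : ℝ :=
  combine (outage μ (net.sinrUB h 0) γ) (outage μ (net.sinrUB h 1) γ)

/-! ### Closed-form expressions -/

/-- The mean of `γ₀`. -/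
def gbar₀ : ℝ := net.P * net.variance .direct

/-- The mean of `γᵢ`. -/
def gbar (i : Fin 2) : ℝ := net.P * net.variance (.relay i)

/-- Mean received power of the `k`-th interferer of node `N`. -/
def ξ (N : Node) (k : Fin (net.L N)) : ℝ := net.PI N * net.variance (.interf N k)

/-- The coefficients of the density `∑ k, φ k * exp (-t / ξ k)` of the interference power `Γ`. -/
def φ (N : Node) (k : Fin (net.L N)) : ℝ :=
  net.ξ N k ^ ((net.L N : ℤ) - 2) * ∏ i ∈ Finset.univ.erase k, 1 / (net.ξ N k - net.ξ N i)

/-- `Φ₁` and `Φ₂` (for `m = 1, 2`) in the formula for terminal `i`. -/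
def Φ (i : Fin 2) (m : ℕ) : ℝ :=
  1 / net.gbar₀ - 1 / net.gbar i
    - (net.ω i + m - 1) / (net.ω (other i) * net.gbar (other i))

/-- `λ₁` and `λ₂` (for `m = 1, 2`) in the formula for terminal `i`. -/
def lam (i : Fin 2) (m : ℕ) : ℝ :=
  1 / net.gbar i + (net.ω i + m - 1) / net.ω (other i) * (1 / net.gbar (other i))

/-- `β` in the formula for terminal `i`. -/
def β (i : Fin 2) (j : Fin (net.L (.T i))) (k : Fin (net.L .R)) : ℝ :=
  net.ω (other i) * net.gbar (other i) * net.Φ i 1 / net.ξ .R k + 1 / net.ξ (.T i) j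

/-- The denominator `γ / γ̄₀ + β`. -/
def D (i : Fin 2) (j : Fin (net.L (.T i))) (k : Fin (net.L .R)) (γ : ℝ) : ℝ :=
  1 / net.gbar₀ * γ + net.β i j k

/-- The function `Λ (ρ₁, ρ₂)`. -/
def Lam (i : Fin 2) (j : Fin (net.L (.T i))) (k : Fin (net.L .R)) (γ ρ₁ ρ₂ : ℝ) : ℝ :=
  net.gbar (other i) / net.D i j k γ * (1 / (ρ₁ * γ + 1 / net.ξ (.T i) j)) * Real.exp (-ρ₂ * γ)

/-- The type of the function `M (ρ₁, ρ₂, ρ₃, ρ₄, ρ₅)`, which also depends on the terminal, on the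
two summation indices and on the threshold. -/
abbrev MFun : Type :=
  (i : Fin 2) → Fin (net.L (.T i)) → Fin (net.L .R) → (γ ρ₁ : ℝ) → (ρ₂ : ℕ) → (ρ₃ ρ₄ ρ₅ : ℝ) → ℝ

/-- The closed-form CDF of the SINR upper bound at terminal `i`, with the function `M` left open. -/
def cdfFormula (M : net.MFun) (i : Fin 2) (γ : ℝ) : ℝ :=
  1 - Real.exp (-(γ / net.gbar₀)) *
      ∑ j, net.φ (.T i) j * (net.gbar₀ / (γ + net.gbar₀ / net.ξ (.T i) j))
    - net.ω (other i) / net.gbar₀ * ∑ j, ∑ k, net.φ (.T i) j * net.φ .R k *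
      (M i j k γ 1 1 (-(1 / net.gbar (other i))) (1 / net.gbar (other i))
          (net.ω (other i) / net.ξ .R k)
        + M i j k γ 1 2 (-(1 / net.gbar (other i))) (1 / net.gbar (other i))
          (net.ω (other i) / net.ξ .R k)
        + M i j k γ (1 / net.ω (other i)) 1 (net.Φ i 1) (net.lam i 1) (1 / net.ξ (.T i) j)
        + M i j k γ (net.Φ i 1 * net.gbar (other i)) 2 (net.Φ i 1) (net.lam i 1)
          (1 / net.ξ (.T i) j)
        + net.Lam i j k γ (net.lam i 1) (net.lam i 2)
        - net.Lam i j k γ (1 / net.gbar₀) (1 / net.gbar₀))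

/-- The `l`-th term of the infinite series in `M`. -/
def seriesTerm (i : Fin 2) (γ ρ₃ ρ₄ ρ₅ : ℝ) (l : ℕ) : ℝ :=
  (-1) ^ l * (ρ₃ / (ρ₄ * γ + ρ₅)) ^ (l + 1) * net.Φ i 2 ^ (-(l : ℤ) - 1)
    * lowerGamma (l + 1) (net.Φ i 2 * γ)

/-- The function `M` as an infinite series; the sum is the limit of the partial sums. -/
def MSeries : net.MFun := fun i j k γ ρ₁ ρ₂ ρ₃ ρ₄ ρ₅ =>
  ρ₁ * Real.exp (-net.lam i 2 * γ) / ρ₃ * net.D i j k γ ^ (-(ρ₂ : ℤ))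
    * ∑'[SummationFilter.conditional ℕ] l, net.seriesTerm i γ ρ₃ ρ₄ ρ₅ l

/-- The function `M` as an integral. -/
def MInt : net.MFun := fun i j k γ ρ₁ ρ₂ ρ₃ ρ₄ ρ₅ =>
  ρ₁ * Real.exp (-net.lam i 2 * γ) * net.D i j k γ ^ (-(ρ₂ : ℤ))
    * ∫ z in (0 : ℝ)..γ, Real.exp (-net.Φ i 2 * z) / (ρ₃ * z + ρ₄ * γ + ρ₅)

/-- The approximation of the integral `M` in which the variable `z` in the denominator of the
integrand is replaced by its largest value `γ`. -/
def MFrozen : net.MFun := fun i j k γ ρ₁ ρ₂ ρ₃ ρ₄ ρ₅ =>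
  ρ₁ * Real.exp (-net.lam i 2 * γ) * net.D i j k γ ^ (-(ρ₂ : ℤ))
    * (1 / ((ρ₃ + ρ₄) * γ + ρ₅)) * ∫ z in (0 : ℝ)..γ, Real.exp (-net.Φ i 2 * z)

/-- The series-free and integral-free function `M̃`. -/
def MTilde : net.MFun := fun i j k γ ρ₁ ρ₂ ρ₃ ρ₄ ρ₅ =>
  ρ₁ * Real.exp (-net.lam i 2 * γ) / net.Φ i 2 * net.D i j k γ ^ (-(ρ₂ : ℤ))
    * ((1 - Real.exp (-net.Φ i 2 * γ)) / ((ρ₃ + ρ₄) * γ + ρ₅))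

/-- The approximation of the protocol outage probability: the lower bound, with the denominators
frozen in all the integrals `M` that occur in the CDFs. -/
def protocolOutageApp (γ : ℝ) : ℝ :=
  combine (net.cdfFormula net.MFrozen 0 γ) (net.cdfFormula net.MFrozen 1 γ)

/-- `(ρ₃, ρ₄, ρ₅)` is one of the two triples for which `M` occurs in the CDF formula. -/
def IsTriple (i : Fin 2) (j : Fin (net.L (.T i))) (k : Fin (net.L .R)) (ρ₃ ρ₄ ρ₅ : ℝ) : Prop :=
  (ρ₃ = -(1 / net.gbar (other i)) ∧ ρ₄ = 1 / net.gbar (other i) ∧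
      ρ₅ = net.ω (other i) / net.ξ .R k) ∨
    (ρ₃ = net.Φ i 1 ∧ ρ₄ = net.lam i 1 ∧ ρ₅ = 1 / net.ξ (.T i) j)

end Network

end TwoWayRelay

end

open TwoWayRelay

/-!
The SINR upper bound at terminal `i` is a function of the squared moduli of the channel
coefficients, which are independent exponential variables (`map_norm_sq_complexGaussian`,
`map_norm_sq_eq_powerLaw`). Given the interference powers `T` at the terminal and `R` at the relay,
the direct SINR is exponential with rate `directRate = (T + 1) / γ̄₀`, and the smaller of the two
relayed SINRs, a minimum of independent exponential variables, is exponential with rate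
`relayRate = λ₁ T + λ₂ + R / (ω γ̄)`, where `ω` and `γ̄` belong to the other terminal. Writing `A`
and `B` for the two rates, the SINR upper bound, the sum of these two variables, is at least `γ`
with conditional probability
`exp (-A γ) + ∫ z in 0..γ, A exp (-A z - B (γ - z))`.

The exponents are affine in `T` and `R`, so averaging over the interference only needs the Laplace
transforms of `T` and `R`, which are independent, and the first derivative of that of `T`, which
accounts for the factor `T + 1` in `A`. The Laplace transform of a sum of independent exponential
variables with distinct means is `∑ k, φ k / (s + 1 / ξ k)`, which is Lagrange interpolation of the
constant `1` (`prod_one_add_mul_inv_eq_sum`, `mgf_interference`). This yields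
`outage_sinrUB_eq_integral`.

What is left is an integral of `exp (-Φ₂ z) (1 / q + 1 / q ^ 2) / p`, with `p` and `q` affine in `z`
and positive on `[0, γ]`. A combination of `p` and `q` is the constant `D`, so partial fractions
reduce it to the two integrals `M` for `p` and `q`, and integration by parts of `1 / q ^ 2` gives
the terms `Λ` (`integral_exp_mul_partialFractions`, `outage_sinrUB_eq_cdfFormula`).

The series is the geometric expansion of `1 / (1 + ρ₃ z / (ρ₄ γ + ρ₅))` integrated term by term
(`hasSum_integral_exp_div_affine`). The remainder after `n` terms is `O (1 / n)` even when the ratio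
reaches `1` at `z = γ`. The error bound for the series-free form is pointwise: the frozen
integrand minus the true one is `ρ₃ (z - γ) / ((ρ₃ + ρ₄) γ + ρ₅)` times the true one.
-/

/-! ### Real integrals and partial fractions -/

namespace TwoWayRelay

/-- Partial fraction expansion of the Laplace transform of a sum of independent exponential
variables with distinct means `x k`: it is Lagrange interpolation of the constant `1` at the nodes
`1 / x k`, evaluated at `-s`. -/
lemma prod_one_add_mul_inv_eq_sum {n : ℕ} (hn : 0 < n) {x : Fin n → ℝ} (hx : ∀ k, 0 < x k)
    (hinj : Function.Injective x) {s : ℝ} (hs : 0 ≤ s) :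
    ∏ k, (1 + s * x k)⁻¹ =
      ∑ k, x k ^ ((n : ℤ) - 2) * (∏ l ∈ Finset.univ.erase k, 1 / (x k - x l)) *
        (s + 1 / x k)⁻¹ := by
  have hpos : ∀ k, 0 < 1 + s * x k := fun k => by have := hx k; positivity
  have hne : ∀ k, x k ≠ 0 := fun k => (hx k).ne'
  have hinj' : Function.Injective fun k => (x k)⁻¹ := inv_injective.comp hinj
  have : Nonempty (Fin n) := ⟨⟨0, hn⟩⟩
  have h1 := congrArg (Polynomial.eval (-s))
    (Lagrange.sum_basis (s := (Finset.univ : Finset (Fin n))) hinj'.injOn Finset.univ_nonempty)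
  rw [Polynomial.eval_finsetSum, Polynomial.eval_one] at h1
  rw [← mul_one (∏ k, (1 + s * x k)⁻¹)]
  nth_rewrite 2 [← h1]
  rw [Finset.mul_sum]
  refine Finset.sum_congr rfl fun k _ => ?_
  have hbasis : Polynomial.eval (-s) (Lagrange.basis Finset.univ (fun k => (x k)⁻¹) k) =
      x k ^ (n - 1) * (∏ l ∈ Finset.univ.erase k, 1 / (x k - x l)) *
        ∏ l ∈ Finset.univ.erase k, (1 + s * x l) := by
    have hcard : x k ^ (n - 1) = ∏ _l ∈ Finset.univ.erase k, x k := by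
      rw [Finset.prod_const, Finset.card_erase_of_mem (Finset.mem_univ k), Finset.card_univ,
        Fintype.card_fin]
    rw [Lagrange.basis, Polynomial.eval_prod, hcard, ← Finset.prod_mul_distrib,
      ← Finset.prod_mul_distrib]
    refine Finset.prod_congr rfl fun l hl => ?_
    have hkl : x k - x l ≠ 0 := sub_ne_zero.2 fun h => (Finset.ne_of_mem_erase hl) (hinj h).symm
    have hlk : x l - x k ≠ 0 := by rw [← neg_sub]; exact neg_ne_zero.2 hkl
    have hk := hne k
    have hl' := hne l
    have hinv : (x k)⁻¹ - (x l)⁻¹ ≠ 0 := by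
      rw [inv_sub_inv hk hl']; exact div_ne_zero hlk (mul_ne_zero hk hl')
    simp only [Lagrange.basisDivisor, Polynomial.eval_mul, Polynomial.eval_C, Polynomial.eval_sub,
      Polynomial.eval_X]
    rw [inv_sub_inv hk hl', inv_div]
    field_simp
    ring
  rw [hbasis, ← Finset.mul_prod_erase _ _ (Finset.mem_univ k), Finset.prod_inv_distrib]
  have hP : ∏ l ∈ Finset.univ.erase k, (1 + s * x l) ≠ 0 :=
    Finset.prod_ne_zero_iff.2 fun l _ => (hpos l).ne'
  have hpow : x k ^ ((n : ℤ) - 2) = x k ^ (n - 1) / x k := by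
    rw [← zpow_natCast, Nat.cast_sub hn, div_eq_mul_inv, ← zpow_sub_one₀ (hne k)]
    congr 1
    push_cast
    ring
  have hk := hne k
  have hk' := (hpos k).ne'
  have hk'' : s + 1 / x k = (1 + s * x k) / x k := by field_simp; ring
  rw [hpow, hk'', inv_div]
  field_simp

lemma affine_pos {ρ c γ z : ℝ} (hc : 0 < c) (hcγ : 0 < ρ * γ + c) (hz : z ∈ Set.Icc 0 γ) :
    0 < ρ * z + c := by
  obtain ⟨h0, h1⟩ := hz
  rcases le_total 0 ρ with h | h
  · nlinarith [mul_nonneg h h0]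
  · nlinarith [mul_nonneg_of_nonpos_of_nonpos h (sub_nonpos.2 h1)]

lemma continuousOn_exp_div_affine {ρ c γ : ℝ} (Φ : ℝ) (hc : 0 < c) (hcγ : 0 < ρ * γ + c) :
    ContinuousOn (fun z => Real.exp (-Φ * z) / (ρ * z + c)) (Set.Icc 0 γ) :=
  ContinuousOn.div (by fun_prop) (by fun_prop) fun _ hz => (affine_pos hc hcγ hz).ne'

lemma lowerGamma_succ_mul (l : ℕ) {Φ : ℝ} (hΦ : Φ ≠ 0) (γ : ℝ) :
    Φ ^ (-(l : ℤ) - 1) * lowerGamma (l + 1) (Φ * γ) =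
      ∫ z in (0 : ℝ)..γ, z ^ l * Real.exp (-Φ * z) := by
  have h := intervalIntegral.integral_comp_mul_left (a := 0) (b := γ)
    (fun t : ℝ => t ^ l * Real.exp (-t)) hΦ
  rw [mul_zero, smul_eq_mul] at h
  have h2 : (fun z : ℝ => (Φ * z) ^ l * Real.exp (-(Φ * z))) =
      fun z => Φ ^ l * (z ^ l * Real.exp (-Φ * z)) := by
    funext z; rw [mul_pow, neg_mul]; ring
  rw [h2, intervalIntegral.integral_const_mul] at h
  have hpow : Φ ^ (-(l : ℤ) - 1) = (Φ ^ l)⁻¹ * Φ⁻¹ := by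
    rw [zpow_sub_one₀ hΦ, zpow_neg, zpow_natCast]
  rw [lowerGamma, Nat.add_sub_cancel, hpow, mul_assoc, ← h, ← mul_assoc,
    inv_mul_cancel₀ (pow_ne_zero l hΦ), one_mul]

/-- Expansion of `∫ exp (-Φ z) / (ρ z + c)` by the geometric series of `1 / (1 + ρ z / c)`.
In the boundary case `|ρ| * γ = c` the series converges only as the limit of its partial sums; the
remainder still vanishes because `∫ (z / γ) ^ n` over `[0, γ]` is `γ / (n + 1)`. -/
lemma hasSum_integral_exp_div_affine {ρ c γ Φ : ℝ} (hΦ : Φ ≠ 0) (hγ : 0 < γ) (hc : 0 < c)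
    (hcγ : 0 < ρ * γ + c) (hle : |ρ| * γ ≤ c) :
    HasSum (fun l : ℕ => (-1) ^ l * (ρ / c) ^ (l + 1) * Φ ^ (-(l : ℤ) - 1)
        * lowerGamma (l + 1) (Φ * γ))
      (ρ * ∫ z in (0 : ℝ)..γ, Real.exp (-Φ * z) / (ρ * z + c))
      (SummationFilter.conditional ℕ) := by
  have hcont := continuousOn_exp_div_affine Φ hc hcγ
  rw [HasSum, SummationFilter.conditional_filter_eq_map_range, Filter.tendsto_map'_iff]
  have hpart : ∀ n : ℕ, ∑ l ∈ Finset.range n, ((-1) ^ l * (ρ / c) ^ (l + 1) * Φ ^ (-(l : ℤ) - 1)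
        * lowerGamma (l + 1) (Φ * γ)) =
      ρ * (∫ z in (0 : ℝ)..γ, Real.exp (-Φ * z) / (ρ * z + c)) -
        ρ * ∫ z in (0 : ℝ)..γ, (-(ρ * z / c)) ^ n * (Real.exp (-Φ * z) / (ρ * z + c)) := by
    intro n
    have hI1 : IntervalIntegrable (fun z => Real.exp (-Φ * z) / (ρ * z + c)) volume 0 γ :=
      ContinuousOn.intervalIntegrable (by rwa [Set.uIcc_of_le hγ.le])
    have hI2 : IntervalIntegrable
        (fun z => (-(ρ * z / c)) ^ n * (Real.exp (-Φ * z) / (ρ * z + c))) volume 0 γ :=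
      ContinuousOn.intervalIntegrable (by
        rw [Set.uIcc_of_le hγ.le]; exact ContinuousOn.mul (by fun_prop) hcont)
    simp_rw [mul_assoc _ _ (lowerGamma _ _), lowerGamma_succ_mul _ hΦ,
      ← intervalIntegral.integral_const_mul]
    rw [← intervalIntegral.integral_finsetSum
      (fun l _ => Continuous.intervalIntegrable (by fun_prop) _ _),
      ← intervalIntegral.integral_sub (hI1.const_mul ρ) (hI2.const_mul ρ)]
    refine intervalIntegral.integral_congr fun z hz => ?_
    rw [Set.uIcc_of_le hγ.le] at hz
    have hq := affine_pos hc hcγ hz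
    have hx : -(ρ * z / c) ≠ 1 := fun h => by
      have : ρ * z = -c := by field_simp at h; linarith
      linarith
    have hterm : ∀ l : ℕ, (-1) ^ l * (ρ / c) ^ (l + 1) * (z ^ l * Real.exp (-Φ * z)) =
        ρ / c * Real.exp (-Φ * z) * (-(ρ * z / c)) ^ l := fun l => by
      rw [show -(ρ * z / c) = -1 * (ρ / c) * z by ring, mul_pow, mul_pow, pow_succ]; ring
    simp only [hterm]
    rw [← Finset.mul_sum, geom_sum_eq hx]
    have h1 : -(ρ * z / c) - 1 = -((ρ * z + c) / c) := by field_simp; ring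
    rw [h1]
    field_simp
    ring
  simp only [Function.comp_def, hpart]
  rw [← sub_zero (ρ * ∫ z in (0 : ℝ)..γ, Real.exp (-Φ * z) / (ρ * z + c))]
  refine Filter.Tendsto.sub (by simp) ?_
  rw [show nhds (0 : ℝ) = nhds (ρ * 0) by rw [mul_zero]]
  refine Filter.Tendsto.const_mul ρ ?_
  obtain ⟨K, hK⟩ := isCompact_Icc.exists_bound_of_continuousOn hcont
  have hb : Filter.Tendsto (fun n : ℕ => K * γ * (1 / ((n : ℝ) + 1))) Filter.atTop (nhds 0) := by
    simpa using tendsto_one_div_add_atTop_nhds_zero_nat.const_mul (K * γ)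
  refine squeeze_zero_norm (fun n => ?_) hb
  have hint : ∫ z in (0 : ℝ)..γ, (z / γ) ^ n * K = K * γ * (1 / ((n : ℝ) + 1)) := by
    simp_rw [div_pow, div_mul_eq_mul_div, mul_div_assoc]
    rw [intervalIntegral.integral_mul_const, integral_pow]
    have := hγ.ne'
    simp only [ne_eq, Nat.add_eq_zero_iff, one_ne_zero, and_false, not_false_eq_true, zero_pow,
      sub_zero]
    field_simp
    ring
  have hg : Continuous fun z : ℝ => (z / γ) ^ n * K := by fun_prop
  rw [← hint]
  refine intervalIntegral.norm_integral_le_of_norm_le hγ.le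
    (Filter.Eventually.of_forall fun z hz => ?_) (hg.intervalIntegrable 0 γ)
  have hz' : z ∈ Set.Icc 0 γ := ⟨hz.1.le, hz.2⟩
  rw [norm_mul, norm_pow, norm_neg]
  refine mul_le_mul (pow_le_pow_left₀ (norm_nonneg _) ?_ n) (hK z hz') (norm_nonneg _)
    (pow_nonneg (div_nonneg hz'.1 hγ.le) n)
  rw [Real.norm_eq_abs, abs_div, abs_mul, abs_of_nonneg hz'.1, abs_of_pos hc,
    div_le_div_iff₀ hc hγ]
  nlinarith [mul_le_mul_of_nonneg_right hle hz'.1]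

lemma integral_exp_neg_mul {Φ : ℝ} (hΦ : Φ ≠ 0) (γ : ℝ) :
    ∫ z in (0 : ℝ)..γ, Real.exp (-Φ * z) = (1 - Real.exp (-Φ * γ)) / Φ := by
  rw [intervalIntegral.integral_comp_mul_left (fun x => Real.exp x) (neg_ne_zero.2 hΦ),
    integral_exp, mul_zero, Real.exp_zero, smul_eq_mul]
  field_simp
  ring

/-- Replacing `z` by `γ` in the denominator changes the integral by a relative error of at most
`|ρ| * γ / (ρ * γ + c)`. -/
lemma abs_frozen_sub_integral_le {ρ c γ : ℝ} (Φ : ℝ) (hγ : 0 < γ) (hc : 0 < c)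
    (hcγ : 0 < ρ * γ + c) :
    |(1 / (ρ * γ + c)) * (∫ z in (0 : ℝ)..γ, Real.exp (-Φ * z)) -
        ∫ z in (0 : ℝ)..γ, Real.exp (-Φ * z) / (ρ * z + c)| ≤
      |ρ| * γ / (ρ * γ + c) * |∫ z in (0 : ℝ)..γ, Real.exp (-Φ * z) / (ρ * z + c)| := by
  have hI : IntervalIntegrable (fun z => Real.exp (-Φ * z) / (ρ * z + c)) volume 0 γ :=
    ContinuousOn.intervalIntegrable (by
      rw [Set.uIcc_of_le hγ.le]; exact continuousOn_exp_div_affine Φ hc hcγ)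
  have hnn : 0 ≤ ∫ z in (0 : ℝ)..γ, Real.exp (-Φ * z) / (ρ * z + c) :=
    intervalIntegral.integral_nonneg hγ.le fun z hz =>
      div_nonneg (Real.exp_pos _).le (affine_pos hc hcγ hz).le
  rw [abs_of_nonneg hnn, ← intervalIntegral.integral_const_mul,
    ← intervalIntegral.integral_const_mul, ← intervalIntegral.integral_sub
      (Continuous.intervalIntegrable (by fun_prop) _ _) hI, ← Real.norm_eq_abs]
  refine intervalIntegral.norm_integral_le_of_norm_le hγ.le
    (Filter.Eventually.of_forall fun z hz => ?_) (hI.const_mul _)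
  have hz' : z ∈ Set.Icc 0 γ := ⟨hz.1.le, hz.2⟩
  have hq := affine_pos hc hcγ hz'
  have hE := Real.exp_pos (-Φ * z)
  have h1 : 1 / (ρ * γ + c) * Real.exp (-Φ * z) - Real.exp (-Φ * z) / (ρ * z + c) =
      ρ * (z - γ) / (ρ * γ + c) * (Real.exp (-Φ * z) / (ρ * z + c)) := by
    field_simp
    ring
  rw [h1, norm_mul, Real.norm_eq_abs, Real.norm_eq_abs, abs_div, abs_mul, abs_of_pos hcγ,
    abs_of_pos (div_pos hE hq)]
  have h2 : |z - γ| ≤ γ := by rw [abs_le]; constructor <;> linarith [hz'.1, hz'.2]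
  gcongr

/-- The integral behind the closed form. Writing `q = Φ₁ z + b` and `p = (γ - z) / g + v`, the
combination `q + Φ₁ g p` is the constant `D`, which decomposes `1 / (p q)` and `1 / (p q ^ 2)` into
partial fractions. The term with `1 / q ^ 2` is removed by integrating the derivative of
`exp (-Φ₂ z) / q`, which produces the boundary terms. -/
lemma integral_exp_mul_partialFractions {Φ₁ Φ₂ b g v γ D : ℝ} (hγ : 0 < γ) (hg : 0 < g)
    (hv : 0 < v) (hb : 0 < b) (hbγ : 0 < Φ₁ * γ + b) (hD : D = Φ₁ * γ + b + Φ₁ * g * v)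
    (hD0 : D ≠ 0) :
    ∫ z in (0 : ℝ)..γ, Real.exp (-Φ₂ * z) *
        (((Φ₁ * z + b)⁻¹ + ((Φ₁ * z + b) ^ 2)⁻¹) * (-(1 / g) * z + (1 / g * γ + v))⁻¹) =
      (D⁻¹ + (D ^ 2)⁻¹) *
          (∫ z in (0 : ℝ)..γ, Real.exp (-Φ₂ * z) / (-(1 / g) * z + (1 / g * γ + v))) +
        (g * (Φ₁ - Φ₂) * D⁻¹ + Φ₁ * g * (D ^ 2)⁻¹) *
          (∫ z in (0 : ℝ)..γ, Real.exp (-Φ₂ * z) / (Φ₁ * z + b)) +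
        g / D * (1 / b - Real.exp (-Φ₂ * γ) / (Φ₁ * γ + b)) := by
  have hp0 : 0 < 1 / g * γ + v := by positivity
  have hpγ : 0 < -(1 / g) * γ + (1 / g * γ + v) := by linarith
  have hIp : IntervalIntegrable (fun z => Real.exp (-Φ₂ * z) / (-(1 / g) * z + (1 / g * γ + v)))
      volume 0 γ := ContinuousOn.intervalIntegrable (by
        rw [Set.uIcc_of_le hγ.le]; exact continuousOn_exp_div_affine Φ₂ hp0 hpγ)
  have hIq : IntervalIntegrable (fun z => Real.exp (-Φ₂ * z) / (Φ₁ * z + b)) volume 0 γ :=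
    ContinuousOn.intervalIntegrable (by
      rw [Set.uIcc_of_le hγ.le]; exact continuousOn_exp_div_affine Φ₂ hb hbγ)
  have hcq2 : ContinuousOn (fun z => (-Φ₂ * Real.exp (-Φ₂ * z) * (Φ₁ * z + b) -
      Real.exp (-Φ₂ * z) * Φ₁) / (Φ₁ * z + b) ^ 2) (Set.uIcc 0 γ) := by
    rw [Set.uIcc_of_le hγ.le]
    exact ContinuousOn.div (by fun_prop) (by fun_prop)
      fun z hz => pow_ne_zero 2 (affine_pos hb hbγ hz).ne'
  have hFTC : ∫ z in (0 : ℝ)..γ, (-Φ₂ * Real.exp (-Φ₂ * z) * (Φ₁ * z + b) -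
      Real.exp (-Φ₂ * z) * Φ₁) / (Φ₁ * z + b) ^ 2 =
      Real.exp (-Φ₂ * γ) / (Φ₁ * γ + b) - 1 / b := by
    rw [intervalIntegral.integral_eq_sub_of_hasDerivAt
      (f := fun z => Real.exp (-Φ₂ * z) / (Φ₁ * z + b)) (fun z hz => ?_)
      hcq2.intervalIntegrable]
    · simp
    · rw [Set.uIcc_of_le hγ.le] at hz
      have h1 : HasDerivAt (fun z => Real.exp (-Φ₂ * z)) (-Φ₂ * Real.exp (-Φ₂ * z)) z := by
        have := ((hasDerivAt_id z).const_mul (-Φ₂)).exp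
        simpa [mul_comm] using this
      have h2 : HasDerivAt (fun z => Φ₁ * z + b) Φ₁ z := by
        simpa using ((hasDerivAt_id z).const_mul Φ₁).add_const b
      exact h1.div h2 (affine_pos hb hbγ hz).ne'
  rw [← neg_sub (Real.exp (-Φ₂ * γ) / (Φ₁ * γ + b)), ← hFTC, mul_neg,
    ← intervalIntegral.integral_const_mul, ← intervalIntegral.integral_const_mul,
    ← intervalIntegral.integral_const_mul, ← sub_eq_add_neg,
    ← intervalIntegral.integral_add (hIp.const_mul _) (hIq.const_mul _),
    ← intervalIntegral.integral_sub ((hIp.const_mul _).add (hIq.const_mul _))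
      (hcq2.intervalIntegrable.const_mul _)]
  refine intervalIntegral.integral_congr fun z hz => ?_
  rw [Set.uIcc_of_le hγ.le] at hz
  have hp := affine_pos hp0 hpγ hz
  have hq := affine_pos hb hbγ hz
  have hDz : D = Φ₁ * z + b + Φ₁ * g * (-(1 / g) * z + (1 / g * γ + v)) := by
    rw [hD]; field_simp; ring
  generalize -(1 / g) * z + (1 / g * γ + v) = p at *
  generalize Φ₁ * z + b = q at *
  field_simp
  rw [hDz]
  ring

end TwoWayRelay

/-! ### Exponential laws -/

namespace TwoWayRelay

lemma lintegral_expMeasure (r : ℝ) {f : ℝ → ENNReal} (hf : Measurable f) :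
    ∫⁻ x, f x ∂expMeasure r =
      ∫⁻ x in Set.Ioi (0 : ℝ), ENNReal.ofReal (r * Real.exp (-(r * x))) * f x := by
  have h0 : expMeasure r = volume.withDensity (exponentialPDF r) := rfl
  have hm : Measurable (exponentialPDF r) := (measurable_exponentialPDFReal r).ennreal_ofReal
  rw [h0, lintegral_withDensity_eq_lintegral_mul _ hm hf, setLIntegral_congr Ioi_ae_eq_Ici,
    ← lintegral_indicator measurableSet_Ici]
  refine lintegral_congr fun x => ?_
  rw [Pi.mul_apply]
  by_cases hx : 0 ≤ x
  · rw [Set.indicator_of_mem (Set.mem_Ici.2 hx), exponentialPDF_of_nonneg hx]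
  · rw [Set.indicator_of_notMem (by simpa using hx), exponentialPDF_of_neg (not_le.1 hx), zero_mul]

lemma lintegral_exp_Ioi {r : ℝ} (hr : 0 < r) (a : ℝ) :
    ∫⁻ x in Set.Ioi a, ENNReal.ofReal (r * Real.exp (-(r * x))) =
      ENNReal.ofReal (Real.exp (-(r * a))) := by
  have h1 : ∀ x, r * Real.exp (-(r * x)) = r * Real.exp (-r * x) := fun x => by rw [neg_mul]
  simp_rw [h1]
  rw [← ofReal_integral_eq_lintegral_ofReal ((exp_neg_integrableOn_Ioi a hr).const_mul r)
    (Filter.Eventually.of_forall fun x => by positivity), integral_const_mul,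
    integral_exp_mul_Ioi (neg_neg_iff_pos.2 hr)]
  congr 1
  rw [neg_mul]
  field_simp

lemma expMeasure_Ici {r : ℝ} (hr : 0 < r) (a : ℝ) :
    expMeasure r (Set.Ici a) = ENNReal.ofReal (Real.exp (-(r * max a 0))) := by
  rw [← lintegral_indicator_one measurableSet_Ici, lintegral_expMeasure r
    (measurable_one.indicator measurableSet_Ici), ← lintegral_exp_Ioi hr]
  have h1 : ∀ x, ENNReal.ofReal (r * Real.exp (-(r * x))) * (Set.Ici a).indicator 1 x =
      (Set.Ici a).indicator (fun x => ENNReal.ofReal (r * Real.exp (-(r * x)))) x := fun x => by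
    by_cases hx : x ∈ Set.Ici a <;> simp [hx]
  simp_rw [h1]
  rw [lintegral_indicator measurableSet_Ici, Measure.restrict_restrict measurableSet_Ici]
  refine setLIntegral_congr ?_
  rw [max_comm, ← Set.Ioi_inter_Ioi, Set.inter_comm]
  exact (Filter.EventuallyEq.refl _ _).inter Ioi_ae_eq_Ici.symm

/-- Averaging `exp (-B (γ - k x)⁺)` over an exponential variable `x` of mean `v`. -/
lemma lintegral_exp_neg_mul_max_expMeasure {k v : ℝ} (hk : 0 < k) (hv : 0 < v) (B : ℝ) {γ : ℝ}
    (hγ : 0 < γ) {A : ℝ} (hA : A = 1 / (k * v)) :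
    ∫⁻ x, ENNReal.ofReal (Real.exp (-(B * max (γ - k * x) 0))) ∂expMeasure (1 / v) =
      ENNReal.ofReal (Real.exp (-(A * γ))) +
        ∫⁻ y in Set.Ioc 0 γ, ENNReal.ofReal (A * Real.exp (-(A * y) - B * (γ - y))) := by
  have hA0 : 0 < A := by rw [hA]; positivity
  have himg : (fun x : ℝ => k * x) '' Set.Ioi 0 = Set.Ioi 0 := by
    rw [Set.image_mul_left_Ioi hk, mul_zero]
  have hcv := lintegral_image_eq_lintegral_abs_deriv_mul (s := Set.Ioi (0 : ℝ))
    (f := fun x => k * x) (f' := fun _ => k) measurableSet_Ioi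
    (fun x _ => by simpa using ((hasDerivAt_id x).const_mul k).hasDerivWithinAt)
    (fun x _ y _ h => mul_left_cancel₀ hk.ne' h)
    (fun y => ENNReal.ofReal (A * Real.exp (-(A * y))) *
      ENNReal.ofReal (Real.exp (-(B * max (γ - y) 0))))
  rw [himg] at hcv
  have hstart : ∀ x, ENNReal.ofReal (1 / v * Real.exp (-(1 / v * x))) *
        ENNReal.ofReal (Real.exp (-(B * max (γ - k * x) 0))) =
      ENNReal.ofReal |k| * (ENNReal.ofReal (A * Real.exp (-(A * (k * x)))) *
        ENNReal.ofReal (Real.exp (-(B * max (γ - k * x) 0)))) := fun x => by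
    rw [← mul_assoc, ← ENNReal.ofReal_mul (abs_nonneg k), abs_of_pos hk]
    have h1 : k * (A * Real.exp (-(A * (k * x)))) = 1 / v * Real.exp (-(1 / v * x)) := by
      have h2 : A * k = 1 / v := by rw [hA]; field_simp
      rw [← mul_assoc, mul_comm k A, ← mul_assoc A, h2]
    rw [h1]
  rw [lintegral_expMeasure _ (by fun_prop)]
  simp_rw [hstart]
  rw [← hcv, ← Set.Ioc_union_Ioi_eq_Ioi hγ.le, lintegral_union measurableSet_Ioi
    (Set.Ioc_disjoint_Ioi le_rfl), add_comm, ← lintegral_exp_Ioi hA0 γ]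
  congr 1
  · refine setLIntegral_congr_fun measurableSet_Ioi fun y hy => ?_
    rw [Set.mem_Ioi] at hy
    rw [max_eq_right (by linarith)]
    simp
  · refine setLIntegral_congr_fun measurableSet_Ioc fun y hy => ?_
    rw [max_eq_left (by linarith [hy.2]), ← ENNReal.ofReal_mul (by positivity), mul_assoc,
      ← Real.exp_add, sub_eq_add_neg (-(A * y))]

/-- The squared modulus of a circularly symmetric complex Gaussian variable is exponential. -/
lemma map_norm_sq_complexGaussian {v : ℝ} (hv : 0 < v) :
    (complexGaussian v).map (fun z => ‖z‖ ^ 2) = expMeasure (1 / v) := by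
  refine Measure.ext_of_lintegral _ fun f hf => ?_
  have hm : Measurable (fun p : ℝ × ℝ => (⟨p.1, p.2⟩ : ℂ)) :=
    Complex.measurableEquivRealProd.symm.measurable
  have hv2 : (v / 2).toNNReal ≠ 0 := by
    rw [ne_eq, Real.toNNReal_eq_zero, not_le]; positivity
  have hpdf : ∀ p : ℝ × ℝ, gaussianPDF 0 (v / 2).toNNReal p.1 * gaussianPDF 0 (v / 2).toNNReal p.2 =
      ENNReal.ofReal ((Real.pi * v)⁻¹ * Real.exp (-((p.1 ^ 2 + p.2 ^ 2) / v))) := fun p => by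
    rw [gaussianPDF, gaussianPDF, ← ENNReal.ofReal_mul (gaussianPDFReal_nonneg _ _ _)]
    congr 1
    simp only [gaussianPDFReal, Real.coe_toNNReal _ (by positivity : 0 ≤ v / 2), sub_zero]
    rw [mul_mul_mul_comm, ← Real.exp_add, ← mul_inv, Real.mul_self_sqrt (by positivity)]
    congr 2
    · field_simp
    · field_simp; ring
  have hnorm : ∀ p : ℝ × ℝ, ‖(⟨p.1, p.2⟩ : ℂ)‖ ^ 2 = p.1 ^ 2 + p.2 ^ 2 := fun p => by
    rw [Complex.sq_norm, Complex.normSq_mk]; ring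
  rw [lintegral_map hf (by fun_prop), complexGaussian, lintegral_map (by fun_prop) hm,
    gaussianReal_of_var_ne_zero _ hv2,
    prod_withDensity (measurable_gaussianPDF _ _) (measurable_gaussianPDF _ _),
    lintegral_withDensity_eq_lintegral_mul _ (by fun_prop)
      (by simp_rw [hnorm]; fun_prop)]
  simp only [Pi.mul_apply, hpdf, hnorm]
  rw [← Measure.volume_eq_prod, ← lintegral_comp_polarCoord_symm]
  have hpol : ∀ p : ℝ × ℝ, (polarCoord.symm p).1 ^ 2 + (polarCoord.symm p).2 ^ 2 = p.1 ^ 2 :=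
    fun p => by
      rw [polarCoord_symm_apply]
      simp only [mul_pow]
      rw [← mul_add, Real.cos_sq_add_sin_sq, mul_one]
  simp only [hpol, smul_eq_mul]
  have htarget : polarCoord.target = Set.Ioi (0 : ℝ) ×ˢ Set.Ioo (-Real.pi) Real.pi := rfl
  rw [htarget, Measure.volume_eq_prod, ← Measure.prod_restrict, lintegral_prod _ (by fun_prop)]
  simp only [lintegral_const, Measure.restrict_apply_univ, Real.volume_Ioo]
  have himg : (fun x : ℝ => x ^ 2) '' Set.Ioi 0 = Set.Ioi 0 := by
    ext y
    constructor
    · rintro ⟨x, hx, rfl⟩; exact pow_pos (Set.mem_Ioi.1 hx) 2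
    · intro hy; exact ⟨√y, Real.sqrt_pos.2 hy, Real.sq_sqrt (le_of_lt hy)⟩
  have hcv := lintegral_image_eq_lintegral_abs_deriv_mul (s := Set.Ioi (0 : ℝ))
    (f := fun x => x ^ 2) (f' := fun x => 2 * x) measurableSet_Ioi
    (fun x _ => by simpa using (hasDerivAt_pow 2 x).hasDerivWithinAt)
    (fun x hx y hy h => (pow_left_inj₀ (le_of_lt hx) (le_of_lt hy) two_ne_zero).1 h)
    (fun u => ENNReal.ofReal (1 / v * Real.exp (-(1 / v * u))) * f u)
  rw [himg] at hcv
  rw [lintegral_expMeasure _ hf, hcv]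
  refine setLIntegral_congr_fun measurableSet_Ioi fun x hx => ?_
  have hx' : 0 < x := hx
  rw [mul_comm _ (ENNReal.ofReal _), ← mul_assoc, ← mul_assoc, ← mul_assoc,
    ← ENNReal.ofReal_mul (by linarith [Real.pi_pos]), ← ENNReal.ofReal_mul
      (mul_nonneg (by linarith [Real.pi_pos]) hx'.le),
    ← ENNReal.ofReal_mul (abs_nonneg _), abs_of_pos (by positivity)]
  congr 2
  have h1 : x ^ 2 / v = 1 / v * x ^ 2 := by ring
  rw [h1]
  have := Real.pi_pos
  field_simp
  ring

lemma integral_exp_neg_mul_expMeasure {r s : ℝ} (hr : 0 < r) (hs : 0 ≤ s) :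
    ∫ x, Real.exp (-s * x) ∂expMeasure r = r / (r + s) := by
  rw [integral_eq_lintegral_of_nonneg_ae (Filter.Eventually.of_forall fun x => (Real.exp_pos _).le)
    (by fun_prop), lintegral_expMeasure r (by fun_prop)]
  have h1 : ∀ x, ENNReal.ofReal (r * Real.exp (-(r * x))) * ENNReal.ofReal (Real.exp (-s * x)) =
      ENNReal.ofReal (r / (r + s)) *
        ENNReal.ofReal ((r + s) * Real.exp (-((r + s) * x))) := fun x => by
    rw [← ENNReal.ofReal_mul (by positivity), ← ENNReal.ofReal_mul (by positivity), mul_assoc,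
      ← Real.exp_add, ← mul_assoc, div_mul_cancel₀ _ (by positivity)]
    congr 3
    ring
  simp_rw [h1]
  rw [lintegral_const_mul _ (by fun_prop), lintegral_exp_Ioi (by positivity), mul_zero, neg_zero,
    Real.exp_zero, ENNReal.ofReal_one, mul_one, ENNReal.toReal_ofReal (by positivity)]

lemma ae_nonneg_expMeasure (r : ℝ) : ∀ᵐ x ∂expMeasure r, 0 ≤ x := by
  have h0 : expMeasure r = volume.withDensity (exponentialPDF r) := rfl
  have h1 : {x : ℝ | ¬0 ≤ x} = Set.Iio 0 := by ext x; simp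
  rw [ae_iff, h1, h0, withDensity_apply _ measurableSet_Iio,
    lintegral_exponentialPDF_of_nonpos le_rfl]

/-! ### Integrating out one coordinate of a product measure -/

variable {ι : Type*} [Fintype ι] [DecidableEq ι]

/-- Replacing one coordinate by an independent copy does not change an expectation. -/
lemma lintegral_pi_eq_lintegral_update (μ : ι → Measure ℝ) [∀ i, IsProbabilityMeasure (μ i)]
    (c : ι) {F : (ι → ℝ) → ENNReal} (hF : Measurable F) :
    ∫⁻ w, F w ∂Measure.pi μ = ∫⁻ w, ∫⁻ x, F (Function.update w c x) ∂μ c ∂Measure.pi μ := by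
  have h := lmarginal_singleton (μ := μ) F c
  rw [← h]
  refine lintegral_eq_of_lmarginal_eq {c} hF (hF.lmarginal μ) ?_
  rw [lmarginal_singleton (μ := μ) (∫⋯∫⁻_{c}, F ∂μ) c]
  funext w
  simp_rw [lmarginal_update_of_mem μ (Finset.mem_singleton_self c)]
  simp

/-- If neither the bound `a` nor the factor `G` depends on the exponential coordinate `c`,
integrating that coordinate out turns the event `a ≤ w c` into its probability. -/
lemma lintegral_pi_indicator_mul (μ : ι → Measure ℝ) [∀ i, IsProbabilityMeasure (μ i)]
    (c : ι) {r : ℝ} (hr : 0 < r) (hc : μ c = expMeasure r) {a : (ι → ℝ) → ℝ} (ha : Measurable a)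
    {G : (ι → ℝ) → ENNReal} (hG : Measurable G)
    (ha' : ∀ w x, a (Function.update w c x) = a w) (hG' : ∀ w x, G (Function.update w c x) = G w) :
    ∫⁻ w, {w | a w ≤ w c}.indicator 1 w * G w ∂Measure.pi μ =
      ∫⁻ w, ENNReal.ofReal (Real.exp (-(r * max (a w) 0))) * G w ∂Measure.pi μ := by
  have hS : MeasurableSet {w | a w ≤ w c} := measurableSet_le ha (measurable_pi_apply c)
  rw [lintegral_pi_eq_lintegral_update μ c
    (F := fun w => {w | a w ≤ w c}.indicator 1 w * G w) ((measurable_one.indicator hS).mul hG)]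
  refine lintegral_congr fun w => ?_
  have h1 : ∀ x, {w | a w ≤ w c}.indicator (1 : (ι → ℝ) → ENNReal) (Function.update w c x) =
      (Set.Ici (a w)).indicator 1 x := fun x => by
    simp only [Set.indicator, Set.mem_ofPred_eq, ha', Function.update_self, Set.mem_Ici,
      Pi.one_apply]
  simp_rw [hG', h1]
  rw [lintegral_mul_const _ (measurable_one.indicator measurableSet_Ici),
    lintegral_indicator_one measurableSet_Ici, hc, expMeasure_Ici hr]

end TwoWayRelay

/-! ### The joint law of the channel powers -/

namespace TwoWayRelay

instance : Finite Node :=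
  Finite.of_injective (fun N : Node => match N with | .T i => some i | .R => none) (by
    rintro (i | _) (j | _) h <;> simp_all)

instance (L : Node → ℕ) : Finite (Channel L) :=
  Finite.of_injective
    (fun c : Channel L => (match c with
      | .direct => Sum.inl none
      | .relay i => Sum.inl (some i)
      | .interf N k => Sum.inr ⟨N, k⟩ : Option (Fin 2) ⊕ (Σ N, Fin (L N)))) (by
    rintro (_ | i | ⟨N, k⟩) (_ | j | ⟨M, l⟩) h <;> simp_all)

noncomputable instance (L : Node → ℕ) : Fintype (Channel L) := Fintype.ofFinite _

noncomputable instance (L : Node → ℕ) : DecidableEq (Channel L) := Classical.decEq _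

namespace Network

variable (net : Network)

/-- The joint law of the squared moduli of the channel coefficients: independent exponential
variables with means `variance c`. -/
noncomputable def powerLaw : Measure (Channel net.L → ℝ) :=
  Measure.pi fun c => expMeasure (1 / net.variance c)

instance (c : Channel net.L) : IsProbabilityMeasure (expMeasure (1 / net.variance c)) :=
  isProbabilityMeasure_expMeasure (one_div_pos.2 (net.variance_pos c))

instance : IsProbabilityMeasure net.powerLaw := by
  unfold powerLaw; infer_instance

/-- The interference power at node `N`, as a function of the squared moduli of the channel
coefficients. -/
noncomputable def interference (N : Node) (w : Channel net.L → ℝ) : ℝ :=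
  ∑ k, net.PI N * w (.interf N k)

/-- The SINR upper bound at terminal `i`, as a function of the squared moduli of the channel
coefficients. -/
noncomputable def sinrUBOfPowers (i : Fin 2) (w : Channel net.L → ℝ) : ℝ :=
  net.P * w .direct / (net.interference (.T i) w + 1) +
    min (net.P * w (.relay i) / (net.interference (.T i) w + 1))
      (net.ω (other i) * (net.P * w (.relay (other i))) /
        (net.interference .R w + net.ω i * net.interference (.T i) w + net.ω i + 1))

@[fun_prop]
lemma measurable_interference (N : Node) : Measurable (net.interference N) := by
  unfold interference; fun_prop

@[fun_prop]
lemma measurable_sinrUBOfPowers (i : Fin 2) : Measurable (net.sinrUBOfPowers i) := by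
  unfold sinrUBOfPowers; fun_prop

variable {S : Type*} [MeasurableSpace S]

lemma map_norm_sq_eq_powerLaw {μ : Measure S} [IsProbabilityMeasure μ]
    {h : Channel net.L → S → ℂ} (hh : net.IsFading μ h) :
    μ.map (fun s c => ‖h c s‖ ^ 2) = net.powerLaw := by
  have hind : iIndepFun (fun c => (fun z : ℂ => ‖z‖ ^ 2) ∘ h c) μ :=
    hh.indep.comp (fun _ z => ‖z‖ ^ 2) fun _ => by fun_prop
  have hm : Measurable fun z : ℂ => ‖z‖ ^ 2 := by fun_prop
  have hmeas : ∀ c, AEMeasurable ((fun z : ℂ => ‖z‖ ^ 2) ∘ h c) μ := fun c =>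
    hm.comp_aemeasurable (hh.law c).aemeasurable
  have hpi := (iIndepFun_iff_map_fun_eq_pi_map hmeas).1 hind
  refine hpi.trans ?_
  rw [powerLaw]
  congr 1
  funext c
  rw [← AEMeasurable.map_map_of_aemeasurable hm.aemeasurable (hh.law c).aemeasurable,
    (hh.law c).map_eq, map_norm_sq_complexGaussian (net.variance_pos c)]

lemma outage_sinrUB_eq {μ : Measure S} [IsProbabilityMeasure μ]
    {h : Channel net.L → S → ℂ} (hh : net.IsFading μ h) (i : Fin 2) (γ : ℝ) :
    outage μ (net.sinrUB h i) γ = 1 - net.powerLaw.real {w | γ ≤ net.sinrUBOfPowers i w} := by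
  have hm : AEMeasurable (fun s c => ‖h c s‖ ^ 2) μ :=
    aemeasurable_pi_lambda _ fun c => by
      have := (hh.law c).aemeasurable
      fun_prop
  have hS : MeasurableSet {w | γ ≤ net.sinrUBOfPowers i w} :=
    measurableSet_le measurable_const (by fun_prop)
  have hc : {w | γ ≤ net.sinrUBOfPowers i w}ᶜ = {w | net.sinrUBOfPowers i w < γ} := by
    ext w; simp
  rw [← probReal_compl_eq_one_sub hS, hc, ← net.map_norm_sq_eq_powerLaw hh,
    map_measureReal_apply_of_aemeasurable hm (hc ▸ hS.compl)]
  rfl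

lemma ae_nonneg_powerLaw : ∀ᵐ w ∂net.powerLaw, ∀ c, 0 ≤ w c :=
  ae_all_iff.2 fun c =>
    (Measure.quasiMeasurePreserving_eval (fun c => expMeasure (1 / net.variance c)) c).ae
      (ae_nonneg_expMeasure _)

lemma interference_nonneg (N : Node) {w : Channel net.L → ℝ} (hw : ∀ c, 0 ≤ w c) :
    0 ≤ net.interference N w :=
  Finset.sum_nonneg fun _ _ => mul_nonneg (net.PI_pos N).le (hw _)

/-! ### Laplace transform of the interference -/

lemma iIndepFun_powerLaw : iIndepFun (fun c (w : Channel net.L → ℝ) => w c) net.powerLaw :=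
  iIndepFun_pi (μ := fun c => expMeasure (1 / net.variance c)) (X := fun _ x => x)
    fun _ => aemeasurable_id

lemma integral_comp_eval_powerLaw (c : Channel net.L) {f : ℝ → ℝ} (hf : Measurable f) :
    ∫ w, f (w c) ∂net.powerLaw = ∫ x, f x ∂expMeasure (1 / net.variance c) := by
  have := (measurePreserving_eval (fun c => expMeasure (1 / net.variance c)) c).map_eq
  rw [← this, integral_map (measurable_pi_apply c).aemeasurable (by fun_prop)]
  rfl

lemma mgf_interference (hξ : ∀ N, Function.Injective (net.ξ N)) (N : Node) {s : ℝ} (hs : 0 ≤ s) :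
    mgf (net.interference N) net.powerLaw (-s) = ∑ k, net.φ N k * (s + 1 / net.ξ N k)⁻¹ := by
  have hind : iIndepFun (fun k (w : Channel net.L → ℝ) => net.PI N * w (.interf N k))
      net.powerLaw :=
    (net.iIndepFun_powerLaw.precomp (g := fun k => Channel.interf N k)
      (fun k l h => by simpa using h)).comp (fun _ x => net.PI N * x) fun _ => by fun_prop
  have hsum : net.interference N =
      ∑ k, fun w : Channel net.L → ℝ => net.PI N * w (.interf N k) := by
    funext w; rw [Finset.sum_apply]; rfl
  rw [hsum, hind.mgf_sum (fun k => by fun_prop)]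
  refine Eq.trans ?_ (prod_one_add_mul_inv_eq_sum (net.L_pos N)
    (fun k => mul_pos (net.PI_pos N) (net.variance_pos _)) (hξ N) hs)
  refine Finset.prod_congr rfl fun k _ => ?_
  have hP := net.PI_pos N
  have hv := net.variance_pos (.interf N k)
  have h1 : ∀ x : ℝ, Real.exp (-s * (net.PI N * x)) = Real.exp (-(s * net.PI N) * x) :=
    fun x => by congr 1; ring
  simp only [mgf, h1]
  rw [net.integral_comp_eval_powerLaw (.interf N k)
    (f := fun x => Real.exp (-(s * net.PI N) * x)) (by fun_prop),
    integral_exp_neg_mul_expMeasure (by positivity) (by positivity)]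
  field_simp

lemma integrable_exp_interference (N : Node) {s : ℝ} (hs : 0 ≤ s) :
    Integrable (fun w => Real.exp (-s * net.interference N w)) net.powerLaw := by
  refine (integrable_const (1 : ℝ)).mono' (by fun_prop) ?_
  filter_upwards [net.ae_nonneg_powerLaw] with w hw
  rw [Real.norm_eq_abs, abs_of_pos (Real.exp_pos _), Real.exp_le_one_iff]
  nlinarith [mul_nonneg hs (net.interference_nonneg N hw)]

lemma neg_mem_interior_integrableExpSet (N : Node) {s : ℝ} (hs : 0 < s) :
    -s ∈ interior (integrableExpSet (net.interference N) net.powerLaw) := by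
  refine mem_interior.2 ⟨Set.Iio 0, fun t ht => ?_, isOpen_Iio, by simpa using hs⟩
  have := net.integrable_exp_interference N (s := -t) (by rw [Set.mem_Iio] at ht; linarith)
  rwa [neg_neg] at this

lemma integrable_mul_exp_interference (N : Node) {s : ℝ} (hs : 0 < s) :
    Integrable (fun w => net.interference N w * Real.exp (-s * net.interference N w))
      net.powerLaw := by
  simpa using integrable_pow_mul_exp_of_mem_interior_integrableExpSet
    (net.neg_mem_interior_integrableExpSet N hs) 1

/-- The first moment is the derivative of the moment generating function. -/
lemma integral_mul_exp_interference (hξ : ∀ N, Function.Injective (net.ξ N)) (N : Node) {s : ℝ}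
    (hs : 0 < s) :
    ∫ w, net.interference N w * Real.exp (-s * net.interference N w) ∂net.powerLaw =
      ∑ k, net.φ N k * ((s + 1 / net.ξ N k) ^ 2)⁻¹ := by
  have h1 := hasDerivAt_mgf (net.neg_mem_interior_integrableExpSet N hs)
  have hξpos : ∀ k, 0 < net.ξ N k := fun k => mul_pos (net.PI_pos N) (net.variance_pos _)
  have h2 : HasDerivAt (fun t => ∑ k, net.φ N k * (-t + 1 / net.ξ N k)⁻¹)
      (∑ k, net.φ N k * ((s + 1 / net.ξ N k) ^ 2)⁻¹) (-s) := by
    refine HasDerivAt.fun_sum fun k _ => HasDerivAt.const_mul _ ?_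
    have hne : -(-s) + 1 / net.ξ N k ≠ 0 := by have := hξpos k; rw [neg_neg]; positivity
    have h3 := (((hasDerivAt_id (-s)).neg).add_const (1 / net.ξ N k)).fun_inv hne
    simpa using h3
  -- The closed form of the moment generating function is only used on the negative half line.
  have heq : mgf (net.interference N) net.powerLaw =ᶠ[nhds (-s)]
      fun t => ∑ k, net.φ N k * (-t + 1 / net.ξ N k)⁻¹ := by
    filter_upwards [Iio_mem_nhds (show -s < 0 by linarith)] with t ht
    rw [← net.mgf_interference hξ N (by rw [Set.mem_Iio] at ht; linarith : 0 ≤ -t), neg_neg]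
  exact h1.unique (h2.congr_of_eventuallyEq heq)

lemma indepFun_interference (i : Fin 2) :
    IndepFun (net.interference (.T i)) (net.interference .R) net.powerLaw := by
  have hdis : Disjoint (Finset.univ.image fun k => Channel.interf (L := net.L) (.T i) k)
      (Finset.univ.image fun k => Channel.interf (L := net.L) .R k) := by
    rw [Finset.disjoint_left]
    intro c h1 h2
    obtain ⟨k, _, rfl⟩ := Finset.mem_image.1 h1
    obtain ⟨l, _, h⟩ := Finset.mem_image.1 h2
    simp at h
  have h := net.iIndepFun_powerLaw.indepFun_finset _ _ hdis fun c => measurable_pi_apply c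
  exact h.comp (φ := fun u => ∑ k, net.PI (.T i) *
      u ⟨.interf (.T i) k, Finset.mem_image_of_mem _ (Finset.mem_univ k)⟩)
    (ψ := fun u => ∑ k, net.PI .R *
      u ⟨.interf .R k, Finset.mem_image_of_mem _ (Finset.mem_univ k)⟩)
    (by fun_prop) (by fun_prop)

/-- The Laplace transforms combine by independence of the interference at the two nodes. -/
lemma lintegral_add_one_mul_exp_interference (hξ : ∀ N, Function.Injective (net.ξ N)) (i : Fin 2)
    {s t C : ℝ} (hs : 0 < s) (ht : 0 ≤ t) (hC : 0 ≤ C) :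
    ∫⁻ w, ENNReal.ofReal (C * ((net.interference (.T i) w + 1) *
        Real.exp (-s * net.interference (.T i) w) *
        Real.exp (-t * net.interference .R w))) ∂net.powerLaw =
      ENNReal.ofReal (C * ((∑ k, net.φ (.T i) k * ((s + 1 / net.ξ (.T i) k)⁻¹ +
        ((s + 1 / net.ξ (.T i) k) ^ 2)⁻¹)) * ∑ k, net.φ .R k * (t + 1 / net.ξ .R k)⁻¹)) := by
  have hiT : Integrable (fun w => (net.interference (.T i) w + 1) *
      Real.exp (-s * net.interference (.T i) w)) net.powerLaw := by
    simp_rw [add_mul, one_mul]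
    exact (net.integrable_mul_exp_interference _ hs).add (net.integrable_exp_interference _ hs.le)
  have hind : IndepFun (fun w => (net.interference (.T i) w + 1) *
      Real.exp (-s * net.interference (.T i) w))
      (fun w => Real.exp (-t * net.interference .R w)) net.powerLaw :=
    (net.indepFun_interference i).comp (φ := fun x => (x + 1) * Real.exp (-s * x))
      (ψ := fun x => Real.exp (-t * x)) (by fun_prop) (by fun_prop)
  have hprod := hind.integral_mul_eq_mul_integral hiT.aestronglyMeasurable
    (net.integrable_exp_interference .R ht).aestronglyMeasurable
  have hint := (hind.integrable_mul hiT (net.integrable_exp_interference .R ht)).const_mul C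
  have hT : ∫ w, (net.interference (.T i) w + 1) * Real.exp (-s * net.interference (.T i) w)
      ∂net.powerLaw = ∑ k, net.φ (.T i) k * ((s + 1 / net.ξ (.T i) k)⁻¹ +
        ((s + 1 / net.ξ (.T i) k) ^ 2)⁻¹) := by
    simp_rw [add_mul, one_mul]
    rw [integral_add (net.integrable_mul_exp_interference _ hs)
      (net.integrable_exp_interference _ hs.le), net.integral_mul_exp_interference hξ _ hs]
    have := net.mgf_interference hξ (.T i) hs.le
    rw [mgf] at this
    rw [this, ← Finset.sum_add_distrib]
    exact Finset.sum_congr rfl fun k _ => by ring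
  have hR : ∫ w, Real.exp (-t * net.interference .R w) ∂net.powerLaw =
      ∑ k, net.φ .R k * (t + 1 / net.ξ .R k)⁻¹ := net.mgf_interference hξ .R ht
  rw [← hT, ← hR, ← hprod, ← integral_const_mul, ofReal_integral_eq_lintegral_ofReal hint]
  · rfl
  · filter_upwards [net.ae_nonneg_powerLaw] with w hw
    have := net.interference_nonneg (.T i) hw
    simp only [Pi.mul_apply, Pi.zero_apply]
    positivity

end Network

end TwoWayRelay

/-! ### The distribution of the SINR upper bound -/

namespace TwoWayRelay

lemma other_ne (i : Fin 2) : other i ≠ i := by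
  fin_cases i <;> simp [other]

namespace Network

variable (net : Network)

lemma gbar₀_pos : 0 < net.gbar₀ := mul_pos net.P_pos (net.variance_pos _)

lemma gbar_pos (i : Fin 2) : 0 < net.gbar i := mul_pos net.P_pos (net.variance_pos _)

lemma ξ_pos (N : Node) (k : Fin (net.L N)) : 0 < net.ξ N k :=
  mul_pos (net.PI_pos N) (net.variance_pos _)

lemma lam_pos (i : Fin 2) {m : ℕ} (hm : 1 ≤ m) : 0 < net.lam i m := by
  have h1 := net.gbar_pos i
  have h2 := net.gbar_pos (other i)
  have h3 := net.ω_pos i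
  have h4 := net.ω_pos (other i)
  have h5 : (1 : ℝ) ≤ m := by exact_mod_cast hm
  have h6 : 0 < net.ω i + m - 1 := by linarith
  unfold lam
  positivity

lemma Φ_add_lam (i : Fin 2) (m : ℕ) : net.Φ i m + net.lam i m = 1 / net.gbar₀ := by
  have h1 := (net.gbar_pos (other i)).ne'
  have h2 := (net.ω_pos (other i)).ne'
  unfold Φ lam
  rw [div_mul_div_comm, mul_one]
  ring

lemma Φ_sub_Φ (i : Fin 2) :
    net.gbar (other i) * (net.Φ i 1 - net.Φ i 2) = 1 / net.ω (other i) := by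
  have h1 := (net.gbar_pos (other i)).ne'
  have h2 := (net.ω_pos (other i)).ne'
  unfold Φ
  field_simp
  push_cast
  ring

/-- On `[0, γ]` the argument of the Laplace transform of the interference is positive, as it
interpolates between `λ₁ γ` and `γ / γ̄₀`; `Φ₁` may have either sign. -/
lemma affine_rate_pos (i : Fin 2) {γ z : ℝ} (hγ : 0 < γ) (hz : z ∈ Set.Icc 0 γ) :
    0 < net.Φ i 1 * z + net.lam i 1 * γ := by
  have hlam := net.lam_pos i le_rfl
  have hg0 := net.gbar₀_pos
  refine affine_pos (by positivity) ?_ hz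
  rw [← add_mul, Φ_add_lam]
  positivity

lemma interference_update {N : Node} {c : Channel net.L} (hc : ∀ k, Channel.interf N k ≠ c)
    (w : Channel net.L → ℝ) (x : ℝ) :
    net.interference N (Function.update w c x) = net.interference N w :=
  Finset.sum_congr rfl fun k _ => by rw [Function.update_of_ne (hc k)]

/-- The failure rate of the smaller relayed SINR at terminal `i`, given the interference. -/
noncomputable def relayRate (i : Fin 2) (w : Channel net.L → ℝ) : ℝ :=
  net.lam i 1 * net.interference (.T i) w + net.lam i 2 +
    net.interference .R w / (net.ω (other i) * net.gbar (other i))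

/-- The failure rate of the SINR of the direct channel at terminal `i`, given the
interference. -/
noncomputable def directRate (i : Fin 2) (w : Channel net.L → ℝ) : ℝ :=
  (net.interference (.T i) w + 1) / net.gbar₀

@[fun_prop]
lemma measurable_relayRate (i : Fin 2) : Measurable (net.relayRate i) := by
  unfold relayRate; fun_prop

@[fun_prop]
lemma measurable_directRate (i : Fin 2) : Measurable (net.directRate i) := by
  unfold directRate; fun_prop

/-- The part of the threshold `γ` that the direct channel leaves to the relayed signals. -/
noncomputable def directGap (i : Fin 2) (γ : ℝ) (w : Channel net.L → ℝ) : ℝ :=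
  γ - net.P / (net.interference (.T i) w + 1) * w .direct

/-- The power of the channel between terminal `i` and the relay at which the first relayed SINR
fills the gap left by the direct channel. -/
noncomputable def nearBound (i : Fin 2) (γ : ℝ) (w : Channel net.L → ℝ) : ℝ :=
  (net.interference (.T i) w + 1) / net.P * net.directGap i γ w

/-- The power of the channel between the other terminal and the relay at which the second relayed
SINR fills the gap left by the direct channel. -/
noncomputable def farBound (i : Fin 2) (γ : ℝ) (w : Channel net.L → ℝ) : ℝ :=
  (net.interference .R w + net.ω i * net.interference (.T i) w + net.ω i + 1) /
    (net.ω (other i) * net.P) * net.directGap i γ w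

@[fun_prop]
lemma measurable_directGap (i : Fin 2) (γ : ℝ) : Measurable (net.directGap i γ) := by
  unfold directGap; fun_prop

@[fun_prop]
lemma measurable_nearBound (i : Fin 2) (γ : ℝ) : Measurable (net.nearBound i γ) := by
  unfold nearBound; fun_prop

@[fun_prop]
lemma measurable_farBound (i : Fin 2) (γ : ℝ) : Measurable (net.farBound i γ) := by
  unfold farBound; fun_prop

lemma interference_update_relay (N : Node) (l : Fin 2) (w : Channel net.L → ℝ) (x : ℝ) :
    net.interference N (Function.update w (.relay l) x) = net.interference N w :=
  net.interference_update (fun k => by simp) w x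

lemma directGap_update_relay (i l : Fin 2) (γ : ℝ) (w : Channel net.L → ℝ) (x : ℝ) :
    net.directGap i γ (Function.update w (.relay l) x) = net.directGap i γ w := by
  simp only [directGap, interference_update_relay]
  rw [Function.update_of_ne (by simp)]

lemma nearBound_update_relay (i l : Fin 2) (γ : ℝ) (w : Channel net.L → ℝ) (x : ℝ) :
    net.nearBound i γ (Function.update w (.relay l) x) = net.nearBound i γ w := by
  simp only [nearBound, interference_update_relay, directGap_update_relay]

lemma farBound_update_relay (i l : Fin 2) (γ : ℝ) (w : Channel net.L → ℝ) (x : ℝ) :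
    net.farBound i γ (Function.update w (.relay l) x) = net.farBound i γ w := by
  simp only [farBound, interference_update_relay, directGap_update_relay]

lemma le_sinrUBOfPowers_iff (i : Fin 2) (γ : ℝ) {w : Channel net.L → ℝ} (hw : ∀ c, 0 ≤ w c) :
    γ ≤ net.sinrUBOfPowers i w ↔
      net.nearBound i γ w ≤ w (.relay i) ∧ net.farBound i γ w ≤ w (.relay (other i)) := by
  have hT := net.interference_nonneg (.T i) hw
  have hR := net.interference_nonneg .R hw
  have hωi := net.ω_pos i
  have hωj := net.ω_pos (other i)
  have hP := net.P_pos
  have h1 : net.nearBound i γ w ≤ w (.relay i) ↔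
      net.directGap i γ w ≤ net.P * w (.relay i) / (net.interference (.T i) w + 1) := by
    rw [nearBound, le_div_iff₀ (by positivity), div_mul_eq_mul_div, div_le_iff₀ hP,
      mul_comm (net.directGap i γ w), mul_comm net.P]
  have h2 : net.farBound i γ w ≤ w (.relay (other i)) ↔
      net.directGap i γ w ≤ net.ω (other i) * (net.P * w (.relay (other i))) /
        (net.interference .R w + net.ω i * net.interference (.T i) w + net.ω i + 1) := by
    rw [farBound, le_div_iff₀ (by positivity), div_mul_eq_mul_div, div_le_iff₀ (by positivity),
      mul_comm (net.directGap i γ w), mul_comm (w (.relay (other i))), mul_assoc]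
  have h3 : net.directGap i γ w = γ - net.P * w .direct / (net.interference (.T i) w + 1) := by
    rw [directGap, div_mul_eq_mul_div]
  rw [h1, h2, ← le_min_iff, h3, sub_le_iff_le_add']
  rfl

lemma add_bounds_eq_relayRate_mul (i : Fin 2) (γ : ℝ) {w : Channel net.L → ℝ}
    (hw : ∀ c, 0 ≤ w c) :
    1 / net.variance (.relay i) * max (net.nearBound i γ w) 0 +
        1 / net.variance (.relay (other i)) * max (net.farBound i γ w) 0 =
      net.relayRate i w * max (net.directGap i γ w) 0 := by
  have hT := net.interference_nonneg (.T i) hw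
  have hR := net.interference_nonneg .R hw
  have hωi := net.ω_pos i
  have hωj := net.ω_pos (other i)
  have hP := net.P_pos
  have h1 := net.variance_pos (.relay i)
  have h2 := net.variance_pos (.relay (other i))
  have hmax : ∀ {c : ℝ}, 0 ≤ c →
      max (c * net.directGap i γ w) 0 = c * max (net.directGap i γ w) 0 := fun hc => by
    rw [mul_max_of_nonneg _ _ hc, mul_zero]
  rw [nearBound, farBound, hmax (by positivity), hmax (by positivity), ← mul_assoc, ← mul_assoc,
    ← add_mul]
  congr 1
  simp only [relayRate, lam, gbar]
  field_simp
  push_cast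
  ring

/-- The smaller relayed SINR is a minimum of two exponential variables, given the interference;
the relay channels are integrated out. -/
lemma powerLaw_le_sinrUBOfPowers (i : Fin 2) (γ : ℝ) :
    net.powerLaw {w | γ ≤ net.sinrUBOfPowers i w} =
      ∫⁻ w, ENNReal.ofReal (Real.exp (-(net.relayRate i w * max (net.directGap i γ w) 0)))
        ∂net.powerLaw := by
  have hv := fun c => one_div_pos.2 (net.variance_pos c)
  have hS : MeasurableSet {w | γ ≤ net.sinrUBOfPowers i w} :=
    measurableSet_le measurable_const (by fun_prop)
  have hSb : MeasurableSet {w | net.farBound i γ w ≤ w (.relay (other i))} :=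
    measurableSet_le (by fun_prop) (measurable_pi_apply _)
  have hevent : net.powerLaw {w | γ ≤ net.sinrUBOfPowers i w} =
      ∫⁻ w, {w | net.nearBound i γ w ≤ w (.relay i)}.indicator 1 w *
        {w | net.farBound i γ w ≤ w (.relay (other i))}.indicator 1 w ∂net.powerLaw := by
    rw [← lintegral_indicator_one hS]
    refine lintegral_congr_ae ?_
    filter_upwards [net.ae_nonneg_powerLaw] with w hw
    simp only [Set.indicator, Set.mem_ofPred_eq, net.le_sinrUBOfPowers_iff i γ hw, Pi.one_apply]
    by_cases hA : net.nearBound i γ w ≤ w (.relay i) <;>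
      by_cases hB : net.farBound i γ w ≤ w (.relay (other i)) <;> simp [hA, hB]
  have hnear := lintegral_pi_indicator_mul (fun c => expMeasure (1 / net.variance c)) (.relay i)
    (hv _) rfl (net.measurable_nearBound i γ) (measurable_one.indicator hSb)
    (net.nearBound_update_relay i i γ) (fun w x => by
      simp only [Set.indicator, Set.mem_ofPred_eq, farBound_update_relay, Pi.one_apply]
      rw [Function.update_of_ne (by simpa using other_ne i)])
  have hfar := lintegral_pi_indicator_mul (fun c => expMeasure (1 / net.variance c))
    (.relay (other i)) (hv _) rfl (net.measurable_farBound i γ)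
    (G := fun w => ENNReal.ofReal (Real.exp (-(1 / net.variance (.relay i) *
      max (net.nearBound i γ w) 0)))) (by fun_prop)
    (net.farBound_update_relay i _ γ) (fun w x => by rw [nearBound_update_relay])
  rw [hevent, powerLaw, hnear]
  simp_rw [mul_comm (ENNReal.ofReal _)]
  rw [hfar]
  refine lintegral_congr_ae ?_
  filter_upwards [net.ae_nonneg_powerLaw] with w hw
  rw [← ENNReal.ofReal_mul (Real.exp_pos _).le, ← Real.exp_add, ← neg_add, add_comm,
    net.add_bounds_eq_relayRate_mul i γ hw]

/-- The direct channel is integrated out, and then the interference, by its Laplace transform;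
Tonelli's theorem exchanges the latter with the integral over the share `z` of the threshold that
the direct channel contributes. -/
lemma powerLaw_le_sinrUBOfPowers_eq (hξ : ∀ N, Function.Injective (net.ξ N)) (i : Fin 2) {γ : ℝ}
    (hγ : 0 < γ) :
    net.powerLaw {w | γ ≤ net.sinrUBOfPowers i w} =
      ENNReal.ofReal (Real.exp (-(γ / net.gbar₀)) *
        ∑ k, net.φ (.T i) k * (γ / net.gbar₀ + 1 / net.ξ (.T i) k)⁻¹) +
      ∫⁻ z in Set.Ioc 0 γ, ENNReal.ofReal (1 / net.gbar₀ * Real.exp (-net.lam i 2 * γ) *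
        Real.exp (-net.Φ i 2 * z) *
        ((∑ k, net.φ (.T i) k * ((net.Φ i 1 * z + net.lam i 1 * γ + 1 / net.ξ (.T i) k)⁻¹ +
            ((net.Φ i 1 * z + net.lam i 1 * γ + 1 / net.ξ (.T i) k) ^ 2)⁻¹)) *
          ∑ k, net.φ .R k *
            ((γ - z) / (net.ω (other i) * net.gbar (other i)) + 1 / net.ξ .R k)⁻¹)) := by
  have hg0 := net.gbar₀_pos
  have hmF : Measurable fun w : Channel net.L → ℝ => ENNReal.ofReal (Real.exp
      (-(net.relayRate i w * max (net.directGap i γ w) 0))) := by fun_prop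
  have hdir : ∫⁻ w, ENNReal.ofReal (Real.exp (-(net.relayRate i w *
        max (net.directGap i γ w) 0))) ∂net.powerLaw =
      ∫⁻ w, (ENNReal.ofReal (Real.exp (-(net.directRate i w * γ))) +
        ∫⁻ z in Set.Ioc 0 γ, ENNReal.ofReal (net.directRate i w *
          Real.exp (-(net.directRate i w * z) - net.relayRate i w * (γ - z)))) ∂net.powerLaw := by
    rw [powerLaw, lintegral_pi_eq_lintegral_update _ .direct hmF]
    refine lintegral_congr_ae ?_
    filter_upwards [net.ae_nonneg_powerLaw] with w hw
    have hT := net.interference_nonneg (.T i) hw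
    have h1 : ∀ x N, net.interference N (Function.update w .direct x) = net.interference N w :=
      fun x N => net.interference_update (fun k => by simp) w x
    simp only [relayRate, directGap, h1, Function.update_self]
    refine lintegral_exp_neg_mul_max_expMeasure (div_pos net.P_pos (by positivity))
      (net.variance_pos .direct) _ hγ ?_
    rw [directRate, gbar₀]
    have := net.P_pos
    have := net.variance_pos .direct
    field_simp
  rw [net.powerLaw_le_sinrUBOfPowers i γ, hdir, lintegral_add_left (by fun_prop)]
  congr 1
  · have hint := net.integrable_exp_interference (.T i) (s := γ / net.gbar₀) (by positivity)
    have hmgf := net.mgf_interference hξ (.T i) (s := γ / net.gbar₀) (by positivity)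
    rw [← hmgf, mgf, ← integral_const_mul, ofReal_integral_eq_lintegral_ofReal (hint.const_mul _)
      (Filter.Eventually.of_forall fun w => by positivity)]
    refine lintegral_congr fun w => ?_
    rw [← Real.exp_add, directRate]
    congr 2
    ring
  · rw [lintegral_lintegral_swap (by fun_prop)]
    refine setLIntegral_congr_fun measurableSet_Ioc fun z hz => ?_
    have hωj := net.ω_pos (other i)
    have hgj := net.gbar_pos (other i)
    have hs := net.affine_rate_pos i hγ ⟨hz.1.le, hz.2⟩
    have ht : 0 ≤ (γ - z) / (net.ω (other i) * net.gbar (other i)) :=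
      div_nonneg (by linarith [hz.2]) (by positivity)
    rw [← net.lintegral_add_one_mul_exp_interference hξ i hs ht (by positivity)]
    refine lintegral_congr fun w => ?_
    congr 1
    have hsplit : -(net.directRate i w * z) - net.relayRate i w * (γ - z) =
        -net.lam i 2 * γ + -net.Φ i 2 * z +
          -(net.Φ i 1 * z + net.lam i 1 * γ) * net.interference (.T i) w +
          -((γ - z) / (net.ω (other i) * net.gbar (other i))) * net.interference .R w := by
      have h1 : net.directRate i w = (net.interference (.T i) w + 1) * (1 / net.gbar₀) := by
        rw [directRate]; ring
      have h2 : net.directRate i w = net.interference (.T i) w * (net.Φ i 1 + net.lam i 1) +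
          (net.Φ i 2 + net.lam i 2) := by
        rw [h1, Φ_add_lam, Φ_add_lam]; ring
      rw [h2, relayRate]
      ring
    rw [hsplit, Real.exp_add, Real.exp_add, Real.exp_add, directRate]
    ring

lemma sum_φ_inv_nonneg (hξ : ∀ N, Function.Injective (net.ξ N)) (N : Node) {s : ℝ}
    (hs : 0 ≤ s) : 0 ≤ ∑ k, net.φ N k * (s + 1 / net.ξ N k)⁻¹ := by
  rw [← net.mgf_interference hξ N hs]
  exact mgf_nonneg

lemma sum_φ_sq_inv_nonneg (hξ : ∀ N, Function.Injective (net.ξ N)) (N : Node) {s : ℝ}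
    (hs : 0 < s) : 0 ≤ ∑ k, net.φ N k * ((s + 1 / net.ξ N k) ^ 2)⁻¹ := by
  rw [← net.integral_mul_exp_interference hξ N hs]
  refine integral_nonneg_of_ae ?_
  filter_upwards [net.ae_nonneg_powerLaw] with w hw
  exact mul_nonneg (net.interference_nonneg N hw) (Real.exp_pos _).le

/-- The outage probability before the remaining integral is evaluated. The integrand is nonnegative,
since its two sums are moments of the interference, although the coefficients `φ` change sign. -/
lemma outage_sinrUB_eq_integral {S : Type*} [MeasurableSpace S] {μ : Measure S}
    [IsProbabilityMeasure μ] {h : Channel net.L → S → ℂ} (hh : net.IsFading μ h)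
    (hξ : ∀ N, Function.Injective (net.ξ N)) (i : Fin 2) {γ : ℝ} (hγ : 0 < γ) :
    outage μ (net.sinrUB h i) γ = 1 - Real.exp (-(γ / net.gbar₀)) *
        ∑ k, net.φ (.T i) k * (γ / net.gbar₀ + 1 / net.ξ (.T i) k)⁻¹ -
      ∫ z in (0 : ℝ)..γ, 1 / net.gbar₀ * Real.exp (-net.lam i 2 * γ) *
        Real.exp (-net.Φ i 2 * z) *
        ((∑ k, net.φ (.T i) k * ((net.Φ i 1 * z + net.lam i 1 * γ + 1 / net.ξ (.T i) k)⁻¹ +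
            ((net.Φ i 1 * z + net.lam i 1 * γ + 1 / net.ξ (.T i) k) ^ 2)⁻¹)) *
          ∑ k, net.φ .R k *
            ((γ - z) / (net.ω (other i) * net.gbar (other i)) + 1 / net.ξ .R k)⁻¹) := by
  have hg0 := net.gbar₀_pos
  have hωj := net.ω_pos (other i)
  have hgj := net.gbar_pos (other i)
  rw [net.outage_sinrUB_eq hh, measureReal_def, net.powerLaw_le_sinrUBOfPowers_eq hξ i hγ,
    intervalIntegral.integral_of_le hγ.le]
  set f : ℝ → ℝ := fun z => 1 / net.gbar₀ * Real.exp (-net.lam i 2 * γ) *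
        Real.exp (-net.Φ i 2 * z) *
        ((∑ k, net.φ (.T i) k * ((net.Φ i 1 * z + net.lam i 1 * γ + 1 / net.ξ (.T i) k)⁻¹ +
            ((net.Φ i 1 * z + net.lam i 1 * γ + 1 / net.ξ (.T i) k) ^ 2)⁻¹)) *
          ∑ k, net.φ .R k *
            ((γ - z) / (net.ω (other i) * net.gbar (other i)) + 1 / net.ξ .R k)⁻¹) with hf
  have ht : ∀ z ∈ Set.Icc 0 γ, 0 ≤ (γ - z) / (net.ω (other i) * net.gbar (other i)) :=
    fun z hz => div_nonneg (by linarith [hz.2]) (by positivity)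
  have hnn : ∀ z ∈ Set.Icc 0 γ, 0 ≤ f z := fun z hz => by
    have hs := net.affine_rate_pos i hγ hz
    have h1 := net.sum_φ_inv_nonneg hξ .R (ht z hz)
    have h2 := add_nonneg (net.sum_φ_inv_nonneg hξ (.T i) hs.le)
      (net.sum_φ_sq_inv_nonneg hξ (.T i) hs)
    rw [← Finset.sum_add_distrib] at h2
    simp only [← mul_add] at h2
    simp only [hf]
    positivity
  have hcont : ContinuousOn f (Set.Icc 0 γ) := by
    refine ContinuousOn.mul (by fun_prop) (ContinuousOn.mul ?_ ?_)
    · refine continuousOn_finsetSum _ fun k _ => continuousOn_const.mul (ContinuousOn.add ?_ ?_)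
      · refine ContinuousOn.inv₀ (by fun_prop) fun z hz => ?_
        have := net.affine_rate_pos i hγ hz
        have := net.ξ_pos (.T i) k
        positivity
      · refine ContinuousOn.inv₀ (by fun_prop) fun z hz => ?_
        have := net.affine_rate_pos i hγ hz
        have := net.ξ_pos (.T i) k
        positivity
    · refine continuousOn_finsetSum _ fun k _ => continuousOn_const.mul ?_
      refine ContinuousOn.inv₀ (by fun_prop) fun z hz => ?_
      have := ht z hz
      have := net.ξ_pos .R k
      positivity
  have hint : Integrable f (volume.restrict (Set.Ioc 0 γ)) :=
    hcont.integrableOn_Icc.mono_set Set.Ioc_subset_Icc_self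
  have hnn' : 0 ≤ᵐ[volume.restrict (Set.Ioc 0 γ)] f :=
    (ae_restrict_iff' measurableSet_Ioc).2
      (Filter.Eventually.of_forall fun z hz => hnn z ⟨hz.1.le, hz.2⟩)
  have hX := net.sum_φ_inv_nonneg hξ (.T i) (s := γ / net.gbar₀) (by positivity)
  rw [← ofReal_integral_eq_lintegral_ofReal hint hnn',
    ENNReal.toReal_add ENNReal.ofReal_ne_top ENNReal.ofReal_ne_top,
    ENNReal.toReal_ofReal (by positivity), ENNReal.toReal_ofReal (integral_nonneg_of_ae hnn'),
    sub_add_eq_sub_sub]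

end Network

end TwoWayRelay

/-! ### The closed forms -/

namespace TwoWayRelay

lemma combine_le_combine {p p' q q' : ℝ} (hp : p ≤ p') (hq : q ≤ q') (hp' : p' ≤ 1) (hq1 : q ≤ 1) :
    combine p q ≤ combine p' q' := by
  unfold combine
  nlinarith [mul_nonneg (sub_nonneg.2 hp) (sub_nonneg.2 hq1),
    mul_nonneg (sub_nonneg.2 hq) (sub_nonneg.2 hp')]

/-- Half the harmonic mean is at most the minimum; at `x = y = 0` the quotient is `0 / 0 = 0`. -/
lemma mul_div_add_le_min {x y : ℝ} (hx : 0 ≤ x) (hy : 0 ≤ y) : x * y / (x + y) ≤ min x y := by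
  rcases hx.eq_or_lt with rfl | hx'
  · simp [hy]
  have hxy : 0 < x + y := by linarith
  rw [le_min_iff, div_le_iff₀ hxy, div_le_iff₀ hxy]
  constructor <;> nlinarith

lemma sum_mul_integral_eq {J K : Type*} [Fintype J] [Fintype K] {a b : ℝ} (c : J → K → ℝ)
    {G : J → K → ℝ → ℝ} (hG : ∀ j k, IntervalIntegrable (G j k) volume a b) :
    ∑ j, ∑ k, c j k * ∫ z in a..b, G j k z = ∫ z in a..b, ∑ j, ∑ k, c j k * G j k z := by
  have hI := fun j k => (hG j k).const_mul (c j k)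
  have hJ : ∀ j, IntervalIntegrable (fun z => ∑ k, c j k * G j k z) volume a b := fun j => by
    simpa only [Finset.sum_fn] using IntervalIntegrable.sum Finset.univ fun k _ => hI j k
  rw [intervalIntegral.integral_finsetSum fun j _ => hJ j]
  refine Finset.sum_congr rfl fun j _ => ?_
  rw [intervalIntegral.integral_finsetSum fun k _ => hI j k]
  simp_rw [intervalIntegral.integral_const_mul]

namespace Network

variable (net : Network)

lemma sinr_le_sinrUB {S : Type*} (h : Channel net.L → S → ℂ) (i : Fin 2) (s : S) :
    net.sinr h i s ≤ net.sinrUB h i s := by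
  have hP := net.P_pos
  have hΓ : ∀ N, 0 ≤ net.Γ h N s := fun N =>
    Finset.sum_nonneg fun k _ => mul_nonneg (net.PI_pos N).le (sq_nonneg _)
  have hT := hΓ (.T i)
  have hR := hΓ .R
  have hωi := net.ω_pos i
  have hωj := net.ω_pos (other i)
  refine add_le_add_right (mul_div_add_le_min ?_ ?_) _
  · unfold sinr₁ gain; positivity
  · unfold sinr₂ gain; positivity

lemma protocolOutageLB_le {S : Type*} [MeasurableSpace S] (μ : Measure S)
    [IsProbabilityMeasure μ] (h : Channel net.L → S → ℂ) (γ : ℝ) :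
    net.protocolOutageLB μ h γ ≤ net.protocolOutage μ h γ := by
  have hle : ∀ i, outage μ (net.sinrUB h i) γ ≤ outage μ (net.sinr h i) γ := fun i =>
    measureReal_mono fun s hs => lt_of_le_of_lt (net.sinr_le_sinrUB h i s) hs
  exact combine_le_combine (hle 0) (hle 1) measureReal_le_one measureReal_le_one

lemma IsTriple.pos {net : Network} {i : Fin 2} {j : Fin (net.L (.T i))} {k : Fin (net.L .R)}
    {ρ₃ ρ₄ ρ₅ γ : ℝ} (h : net.IsTriple i j k ρ₃ ρ₄ ρ₅) (hγ : 0 < γ) :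
    0 < ρ₄ * γ + ρ₅ ∧ 0 < ρ₃ * γ + (ρ₄ * γ + ρ₅) := by
  rcases h with ⟨rfl, rfl, rfl⟩ | ⟨rfl, rfl, rfl⟩
  · have h1 := net.gbar_pos (other i)
    have h2 := net.ω_pos (other i)
    have h3 := net.ξ_pos .R k
    refine ⟨by positivity, ?_⟩
    rw [neg_mul, neg_add_cancel_left]
    positivity
  · have h1 := net.lam_pos i le_rfl
    have h2 := net.ξ_pos (.T i) j
    have h3 := net.affine_rate_pos i hγ ⟨hγ.le, le_rfl⟩
    refine ⟨by positivity, ?_⟩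
    rw [← add_assoc]
    positivity

/-- The closed form evaluates `M` only at the two triples. -/
lemma cdfFormula_congr {M M' : net.MFun} (i : Fin 2) (γ : ℝ)
    (h : ∀ j k ρ₁ ρ₂ ρ₃ ρ₄ ρ₅, net.IsTriple i j k ρ₃ ρ₄ ρ₅ →
      M i j k γ ρ₁ ρ₂ ρ₃ ρ₄ ρ₅ = M' i j k γ ρ₁ ρ₂ ρ₃ ρ₄ ρ₅) :
    net.cdfFormula M i γ = net.cdfFormula M' i γ := by
  have h1 := fun j k ρ₁ ρ₂ => h j k ρ₁ ρ₂ _ _ _ (Or.inl ⟨rfl, rfl, rfl⟩)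
  have h2 := fun j k ρ₁ ρ₂ => h j k ρ₁ ρ₂ _ _ _ (Or.inr ⟨rfl, rfl, rfl⟩)
  simp only [cdfFormula, h1, h2]

/-- The contribution of one interferer of the terminal and one of the relay to the closed form. -/
lemma exp_mul_integral_eq (i : Fin 2) (j : Fin (net.L (.T i))) (k : Fin (net.L .R)) {γ : ℝ}
    (hγ : 0 < γ) (hD : net.D i j k γ ≠ 0) :
    Real.exp (-net.lam i 2 * γ) * ∫ z in (0 : ℝ)..γ, Real.exp (-net.Φ i 2 * z) *
        (((net.Φ i 1 * z + (net.lam i 1 * γ + 1 / net.ξ (.T i) j))⁻¹ +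
            ((net.Φ i 1 * z + (net.lam i 1 * γ + 1 / net.ξ (.T i) j)) ^ 2)⁻¹) *
          (-(1 / net.gbar (other i)) * z +
            (1 / net.gbar (other i) * γ + net.ω (other i) / net.ξ .R k))⁻¹) =
      net.MInt i j k γ 1 1 (-(1 / net.gbar (other i))) (1 / net.gbar (other i))
          (net.ω (other i) / net.ξ .R k)
        + net.MInt i j k γ 1 2 (-(1 / net.gbar (other i))) (1 / net.gbar (other i))
          (net.ω (other i) / net.ξ .R k)
        + net.MInt i j k γ (1 / net.ω (other i)) 1 (net.Φ i 1) (net.lam i 1) (1 / net.ξ (.T i) j)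
        + net.MInt i j k γ (net.Φ i 1 * net.gbar (other i)) 2 (net.Φ i 1) (net.lam i 1)
          (1 / net.ξ (.T i) j)
        + net.Lam i j k γ (net.lam i 1) (net.lam i 2)
        - net.Lam i j k γ (1 / net.gbar₀) (1 / net.gbar₀) := by
  have hg := net.gbar_pos (other i)
  have hω := net.ω_pos (other i)
  have hξR := net.ξ_pos .R k
  obtain ⟨hb, hbγ⟩ := IsTriple.pos (net := net) (j := j) (k := k) (Or.inr ⟨rfl, rfl, rfl⟩) hγ
  have hDeq : net.D i j k γ = net.Φ i 1 * γ + (net.lam i 1 * γ + 1 / net.ξ (.T i) j) +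
      net.Φ i 1 * net.gbar (other i) * (net.ω (other i) / net.ξ .R k) := by
    rw [D, β, ← net.Φ_add_lam i 1]
    ring
  have hexp : Real.exp (-net.lam i 2 * γ) * Real.exp (-net.Φ i 2 * γ) =
      Real.exp (-(1 / net.gbar₀) * γ) := by
    rw [← Real.exp_add, ← net.Φ_add_lam i 2]
    congr 1
    ring
  have hend : net.Φ i 1 * γ + (net.lam i 1 * γ + 1 / net.ξ (.T i) j) =
      1 / net.gbar₀ * γ + 1 / net.ξ (.T i) j := by
    rw [← net.Φ_add_lam i 1]; ring
  rw [integral_exp_mul_partialFractions hγ hg (div_pos hω hξR) hb hbγ hDeq hD, net.Φ_sub_Φ i, hend]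
  simp only [MInt, Lam, add_assoc, zpow_neg, zpow_natCast, pow_one]
  rw [← hexp]
  ring

lemma outage_sinrUB_eq_cdfFormula {S : Type*} [MeasurableSpace S] {μ : Measure S}
    [IsProbabilityMeasure μ] {h : Channel net.L → S → ℂ} (hh : net.IsFading μ h)
    (hξ : ∀ N, Function.Injective (net.ξ N)) (i : Fin 2) {γ : ℝ} (hγ : 0 < γ)
    (hD : ∀ j k, net.D i j k γ ≠ 0) :
    outage μ (net.sinrUB h i) γ = net.cdfFormula net.MInt i γ := by
  have hg0 := net.gbar₀_pos
  have hg := net.gbar_pos (other i)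
  have hω := net.ω_pos (other i)
  rw [net.outage_sinrUB_eq_integral hh hξ i hγ, cdfFormula]
  congr 1
  · congr 2
    refine Finset.sum_congr rfl fun k _ => ?_
    have := net.ξ_pos (.T i) k
    congr 1
    field_simp
  · simp only [← net.exp_mul_integral_eq i _ _ hγ (hD _ _)]
    have hcont : ∀ j k, ContinuousOn (fun z => Real.exp (-net.Φ i 2 * z) *
        (((net.Φ i 1 * z + (net.lam i 1 * γ + 1 / net.ξ (.T i) j))⁻¹ +
            ((net.Φ i 1 * z + (net.lam i 1 * γ + 1 / net.ξ (.T i) j)) ^ 2)⁻¹) *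
          (-(1 / net.gbar (other i)) * z +
            (1 / net.gbar (other i) * γ + net.ω (other i) / net.ξ .R k))⁻¹)) (Set.uIcc 0 γ) := by
      intro j k
      rw [Set.uIcc_of_le hγ.le]
      obtain ⟨hb, hbγ⟩ := IsTriple.pos (net := net) (j := j) (k := k) (Or.inr ⟨rfl, rfl, rfl⟩) hγ
      obtain ⟨hc, hcγ⟩ := IsTriple.pos (net := net) (j := j) (k := k) (Or.inl ⟨rfl, rfl, rfl⟩) hγ
      refine ContinuousOn.mul (by fun_prop) (ContinuousOn.mul (ContinuousOn.add ?_ ?_) ?_)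
      · exact ContinuousOn.inv₀ (by fun_prop) fun z hz => (affine_pos hb hbγ hz).ne'
      · exact ContinuousOn.inv₀ (by fun_prop) fun z hz => pow_ne_zero 2 (affine_pos hb hbγ hz).ne'
      · exact ContinuousOn.inv₀ (by fun_prop) fun z hz => (affine_pos hc hcγ hz).ne'
    refine Eq.trans ?_ ((sum_mul_integral_eq (fun j k => net.ω (other i) / net.gbar₀ *
      (net.φ (.T i) j * net.φ .R k * Real.exp (-net.lam i 2 * γ)))
      fun j k => (hcont j k).intervalIntegrable).symm.trans ?_)
    · refine intervalIntegral.integral_congr fun z hz => ?_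
      rw [Set.uIcc_of_le hγ.le] at hz
      have hp : ∀ k, ((γ - z) / (net.ω (other i) * net.gbar (other i)) + 1 / net.ξ .R k)⁻¹ =
          net.ω (other i) * (-(1 / net.gbar (other i)) * z +
            (1 / net.gbar (other i) * γ + net.ω (other i) / net.ξ .R k))⁻¹ := fun k => by
        have hξR := net.ξ_pos .R k
        have h1 : (γ - z) / (net.ω (other i) * net.gbar (other i)) + 1 / net.ξ .R k =
            (net.ω (other i))⁻¹ * (-(1 / net.gbar (other i)) * z +
              (1 / net.gbar (other i) * γ + net.ω (other i) / net.ξ .R k)) := by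
          field_simp
          ring
        rw [h1, mul_inv, inv_inv]
      simp only [hp, add_assoc]
      rw [Finset.sum_mul_sum, Finset.mul_sum]
      refine Finset.sum_congr rfl fun j _ => ?_
      rw [Finset.mul_sum]
      exact Finset.sum_congr rfl fun k _ => by ring
    · rw [Finset.mul_sum]
      refine Finset.sum_congr rfl fun j _ => ?_
      rw [Finset.mul_sum]
      exact Finset.sum_congr rfl fun k _ => by ring

lemma MSeries_eq_MInt {i : Fin 2} {j : Fin (net.L (.T i))} {k : Fin (net.L .R)}
    {γ ρ₃ ρ₄ ρ₅ : ℝ} (hs : HasSum (net.seriesTerm i γ ρ₃ ρ₄ ρ₅)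
      (ρ₃ * ∫ z in (0 : ℝ)..γ, Real.exp (-net.Φ i 2 * z) / (ρ₃ * z + (ρ₄ * γ + ρ₅)))
      (SummationFilter.conditional ℕ)) (h₃ : ρ₃ ≠ 0) (ρ₁ : ℝ) (ρ₂ : ℕ) :
    net.MSeries i j k γ ρ₁ ρ₂ ρ₃ ρ₄ ρ₅ = net.MInt i j k γ ρ₁ ρ₂ ρ₃ ρ₄ ρ₅ := by
  simp only [MSeries, MInt, hs.tsum_eq, add_assoc]
  field_simp

/-- For the triple of the relay the ratio of the series is smaller than `1` in absolute value; for
the triple of the terminal the bound is assumed. -/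
lemma hasSum_seriesTerm {i : Fin 2} {j : Fin (net.L (.T i))} {k : Fin (net.L .R)}
    {γ ρ₃ ρ₄ ρ₅ : ℝ} (hγ : 0 < γ) (hΦ₂ : net.Φ i 2 ≠ 0)
    (hle : |net.Φ i 1| * γ ≤ net.lam i 1 * γ + 1 / net.ξ (.T i) j)
    (h : net.IsTriple i j k ρ₃ ρ₄ ρ₅) :
    HasSum (net.seriesTerm i γ ρ₃ ρ₄ ρ₅)
      (ρ₃ * ∫ z in (0 : ℝ)..γ, Real.exp (-net.Φ i 2 * z) / (ρ₃ * z + (ρ₄ * γ + ρ₅)))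
      (SummationFilter.conditional ℕ) := by
  obtain ⟨hc, hcγ⟩ := h.pos hγ
  refine hasSum_integral_exp_div_affine hΦ₂ hγ hc hcγ ?_
  rcases h with ⟨rfl, rfl, rfl⟩ | ⟨rfl, rfl, rfl⟩
  · have h1 := net.gbar_pos (other i)
    have h2 := net.ω_pos (other i)
    have h3 := net.ξ_pos .R k
    rw [abs_neg, abs_of_pos (by positivity)]
    have : 0 < net.ω (other i) / net.ξ .R k := by positivity
    linarith
  · exact hle

lemma IsTriple.ne_zero {net : Network} {i : Fin 2} {j : Fin (net.L (.T i))} {k : Fin (net.L .R)}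
    {ρ₃ ρ₄ ρ₅ : ℝ} (h : net.IsTriple i j k ρ₃ ρ₄ ρ₅) (hΦ₁ : net.Φ i 1 ≠ 0) : ρ₃ ≠ 0 := by
  rcases h with ⟨rfl, _, _⟩ | ⟨rfl, _, _⟩
  · exact neg_ne_zero.2 (one_div_pos.2 (net.gbar_pos _)).ne'
  · exact hΦ₁

lemma MTilde_eq_MFrozen {i : Fin 2} (hΦ₂ : net.Φ i 2 ≠ 0) (j : Fin (net.L (.T i)))
    (k : Fin (net.L .R)) (γ ρ₁ : ℝ) (ρ₂ : ℕ) (ρ₃ ρ₄ ρ₅ : ℝ) :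
    net.MTilde i j k γ ρ₁ ρ₂ ρ₃ ρ₄ ρ₅ = net.MFrozen i j k γ ρ₁ ρ₂ ρ₃ ρ₄ ρ₅ := by
  simp only [MTilde, MFrozen, integral_exp_neg_mul hΦ₂]
  ring

lemma abs_MTilde_sub_MInt_le {i : Fin 2} {j : Fin (net.L (.T i))} {k : Fin (net.L .R)}
    {γ ρ₃ ρ₄ ρ₅ : ℝ} (hγ : 0 < γ) (hΦ₂ : net.Φ i 2 ≠ 0) (h : net.IsTriple i j k ρ₃ ρ₄ ρ₅)
    (ρ₁ : ℝ) (ρ₂ : ℕ) :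
    |net.MTilde i j k γ ρ₁ ρ₂ ρ₃ ρ₄ ρ₅ - net.MInt i j k γ ρ₁ ρ₂ ρ₃ ρ₄ ρ₅| ≤
      |ρ₃| * γ / ((ρ₃ + ρ₄) * γ + ρ₅) * |net.MInt i j k γ ρ₁ ρ₂ ρ₃ ρ₄ ρ₅| := by
  obtain ⟨hc, hcγ⟩ := h.pos hγ
  have hbound := abs_frozen_sub_integral_le (net.Φ i 2) hγ hc hcγ
  have hden : (ρ₃ + ρ₄) * γ + ρ₅ = ρ₃ * γ + (ρ₄ * γ + ρ₅) := by ring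
  rw [net.MTilde_eq_MFrozen hΦ₂, MFrozen, MInt, hden]
  simp only [add_assoc]
  rw [mul_assoc _ (1 / _), ← mul_sub, abs_mul, abs_mul _ (∫ z in (0 : ℝ)..γ, _), mul_left_comm]
  exact mul_le_mul_of_nonneg_left hbound (abs_nonneg _)

end Network

end TwoWayRelay

theorem theorem1 (net : Network) {S : Type*} [MeasurableSpace S]
    (μ : Measure S) [IsProbabilityMeasure μ]
    (h : Channel net.L → S → ℂ) (hh : net.IsFading μ h)
    (hξ : ∀ N, Function.Injective (net.ξ N))
    (γth : ℝ) (hγ : 0 < γth)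
    (hΦ₂ : ∀ i, net.Φ i 2 ≠ 0)
    (hD : ∀ i j k, net.D i j k γth ≠ 0) :
    -- the lower bound, with `M` as an integral
    net.protocolOutageLB μ h γth ≤ net.protocolOutage μ h γth ∧
    (∀ i, outage μ (net.sinrUB h i) γth = net.cdfFormula net.MInt i γth) ∧
    net.protocolOutageLB μ h γth =
      combine (net.cdfFormula net.MInt 0 γth) (net.cdfFormula net.MInt 1 γth) ∧
    -- the lower bound, with `M` as a series, wherever the series converges
    ((∀ i, net.Φ i 1 ≠ 0) →
      (∀ i j, |net.Φ i 1| * γth ≤ net.lam i 1 * γth + 1 / net.ξ (.T i) j) →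
      (∀ i j k ρ₃ ρ₄ ρ₅, net.IsTriple i j k ρ₃ ρ₄ ρ₅ →
        Summable (net.seriesTerm i γth ρ₃ ρ₄ ρ₅) (SummationFilter.conditional ℕ)) ∧
      (∀ i, outage μ (net.sinrUB h i) γth = net.cdfFormula net.MSeries i γth) ∧
      net.protocolOutageLB μ h γth =
        combine (net.cdfFormula net.MSeries 0 γth) (net.cdfFormula net.MSeries 1 γth)) ∧
    -- the series-free approximation
    net.protocolOutageApp γth =
      combine (net.cdfFormula net.MTilde 0 γth) (net.cdfFormula net.MTilde 1 γth) ∧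
    (∀ i j k ρ₁ ρ₂ ρ₃ ρ₄ ρ₅, net.IsTriple i j k ρ₃ ρ₄ ρ₅ →
      |net.MTilde i j k γth ρ₁ ρ₂ ρ₃ ρ₄ ρ₅ - net.MInt i j k γth ρ₁ ρ₂ ρ₃ ρ₄ ρ₅| ≤
        |ρ₃| * γth / ((ρ₃ + ρ₄) * γth + ρ₅) * |net.MInt i j k γth ρ₁ ρ₂ ρ₃ ρ₄ ρ₅|) := by
  have hcdf : ∀ i, outage μ (net.sinrUB h i) γth = net.cdfFormula net.MInt i γth := fun i =>
    net.outage_sinrUB_eq_cdfFormula hh hξ i hγ (hD i)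
  have hLB : net.protocolOutageLB μ h γth =
      combine (net.cdfFormula net.MInt 0 γth) (net.cdfFormula net.MInt 1 γth) := by
    rw [Network.protocolOutageLB, hcdf, hcdf]
  refine ⟨net.protocolOutageLB_le μ h γth, hcdf, hLB, fun hΦ₁ hle => ?_, ?_,
    fun i j k ρ₁ ρ₂ ρ₃ ρ₄ ρ₅ hρ => net.abs_MTilde_sub_MInt_le hγ (hΦ₂ i) hρ ρ₁ ρ₂⟩
  · have hseries : ∀ i, net.cdfFormula net.MInt i γth = net.cdfFormula net.MSeries i γth :=
      fun i => net.cdfFormula_congr i γth fun j k ρ₁ ρ₂ ρ₃ ρ₄ ρ₅ hρ =>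
        (net.MSeries_eq_MInt (net.hasSum_seriesTerm hγ (hΦ₂ i) (hle i j) hρ)
          (hρ.ne_zero (hΦ₁ i)) ρ₁ ρ₂).symm
    refine ⟨fun i j k ρ₃ ρ₄ ρ₅ hρ => (net.hasSum_seriesTerm hγ (hΦ₂ i) (hle i j) hρ).summable,
      fun i => (hcdf i).trans (hseries i), ?_⟩
    rw [hLB, hseries, hseries]
  · have hfrozen : ∀ i, net.cdfFormula net.MFrozen i γth = net.cdfFormula net.MTilde i γth :=
      fun i => net.cdfFormula_congr i γth fun j k ρ₁ ρ₂ ρ₃ ρ₄ ρ₅ _ =>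
        (net.MTilde_eq_MFrozen (hΦ₂ i) j k γth ρ₁ ρ₂ ρ₃ ρ₄ ρ₅).symm
    rw [Network.protocolOutageApp, hfrozen, hfrozen]
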